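/- Let $n,k,b$ be integers with $n \ge 0$, $k\ge 1$, $b\ge 0$. Let $G_{n,k,b}$ be the graph whose vertices are the $k$-element subsets $X$ of $\{0,1,\dots,n\}$ with $\max X-\min X\le b$, where two distinct vertices $X,Y$ are adjacent if and only if $\max(X\cup Y)-\min(X\cup Y)\le b$. The bandwidth $B(G)$ of a finite graph $G=(V,E)$ is the minimum, over all bijections $f:V\to\{1,\dots,|V|\}$, of $\max\{|f(u)-f(v)| : \{u,v\}\in E\}$ (with value $0$ if there are no edges). For real sequences, $f(n)\lesssim g(n)$ means that for every $\varepsilon>0$ we have $f(n)\le(1+\varepsilon)g(n)$ for all sufficiently large $n$, and $f(n)\sim g(n)$ means $f(n)/g(n)\to1$, as $n\to\infty$. **Theorem.** Let $k\ge 2$ be a fixed integer, let $\beta\in(0,\tfrac12]$, and let $b=b(n)$ be natural numbers with $b(n)\sim\beta n$ as $n\to\infty$. Write $1=q\beta+r$, where $q\ge 2$ is an integer and $0\le r<\beta$, and put $$c_1=\frac{\beta^k}{k!}\left(k-\frac{k-1}{q}\right),\qquad c_2=\frac{\beta^{k-1}}{(q+1)\,k!}\bigl(k-(k-1)\beta\bigr),\qquad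 c_3=\frac{(\beta-r)^k}{(q+1)\,k!}\,q^{k-1}.$$ (a) If $r\le\dfrac{q-1}{q^2+q-1}$, then $B(G_{n,k,b})\sim c_1n^k$ as $n\to\infty$. (b) If $r>\dfrac{q-1}{q^2+q-1}$, then, as $n\to\infty$, $$\max\left\{c_1,\;c_2+\frac{c_3}{q^{k-1}}\right\}n^k\;\lesssim\;B(G_{n,k,b})\;\lesssim\;(c_2+c_3)\,n^k .$$ -/

import Mathlib

open Filter Asymptotics

/-- For a nonempty finite set of natural numbers, the difference of its maximum and its minimum
(and `0` for the empty set). -/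
def spread (X : Finset ℕ) : ℕ :=
  if h : X.Nonempty then X.max' h - X.min' h else 0

theorem spread_le_iff (X : Finset ℕ) (b : ℕ) :
    spread X ≤ b ↔ ∀ x ∈ X, ∀ y ∈ X, x ≤ y + b := by
  unfold spread
  split_ifs with h
  · constructor
    · intro hb x hx y hy
      have h1 := X.le_max' x hx
      have h2 := X.min'_le y hy
      omega
    · intro H
      have := H _ (X.max'_mem h) _ (X.min'_mem h)
      omega
  · rw [Finset.not_nonempty_iff_eq_empty] at h
    simp [h]

section Bandwidth

variable {V : Type*} [Fintype V]

open Classical in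
/-- The bandwidth of a numbering `f` of the vertices of `G`: the maximum of `|f u - f v|` over the
edges `{u, v}` of `G` (and `0` if there is no edge). The labels are `0, …, |V| - 1`; a shift to
`1, …, |V|` does not change the differences. -/
noncomputable def numberingBandwidth (G : SimpleGraph V) (f : V ≃ Fin (Fintype.card V)) : ℕ :=
  (Finset.univ.filter fun p : V × V => G.Adj p.1 p.2).sup
    fun p => (((f p.1 : ℕ) : ℤ) - ((f p.2 : ℕ) : ℤ)).natAbs

/-- The bandwidth of a finite graph: the minimum of the bandwidths of its numberings
(the infimum of a nonempty family of natural numbers, hence attained). -/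
noncomputable def bandwidth (G : SimpleGraph V) : ℕ :=
  ⨅ f : V ≃ Fin (Fintype.card V), numberingBandwidth G f

end Bandwidth

/-- The vertices of `G_{n,k,b}`: the `k`-element subsets `X` of `{0, …, n}` with
`max X - min X ≤ b`. -/
def vertexFamily (n k b : ℕ) : Finset (Finset ℕ) :=
  ((Finset.range (n + 1)).powersetCard k).filter fun X => spread X ≤ b

/-- The graph `G_{n,k,b}`: two distinct vertices `X`, `Y` are adjacent iff
`max (X ∪ Y) - min (X ∪ Y) ≤ b`. -/
def graphG (n k b : ℕ) : SimpleGraph (vertexFamily n k b) where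
  Adj X Y := X ≠ Y ∧ spread (X.1 ∪ Y.1) ≤ b
  symm := ⟨fun X Y h => ⟨h.1.symm, by rw [Finset.union_comm]; exact h.2⟩⟩
  loopless := ⟨fun _ h => h.1 rfl⟩

/-- `f ≲ g` as `n → ∞`: for every `ε > 0`, eventually `f n ≤ (1 + ε) g n`. -/
def AsympLE (f g : ℕ → ℝ) : Prop :=
  ∀ ε : ℝ, 0 < ε → ∀ᶠ n in atTop, f n ≤ (1 + ε) * g n

/-- `c₁ = (β ^ k / k!) (k - (k - 1) / q)`. -/
noncomputable def c₁ (β : ℝ) (k q : ℕ) : ℝ :=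
  β ^ k / (k.factorial : ℝ) * ((k : ℝ) - ((k : ℝ) - 1) / (q : ℝ))

/-- `c₂ = (β ^ (k - 1) / ((q + 1) k!)) (k - (k - 1) β)`. -/
noncomputable def c₂ (β : ℝ) (k q : ℕ) : ℝ :=
  β ^ (k - 1) / (((q : ℝ) + 1) * (k.factorial : ℝ)) * ((k : ℝ) - ((k : ℝ) - 1) * β)

/-- `c₃ = ((β - r) ^ k / ((q + 1) k!)) q ^ (k - 1)`. -/
noncomputable def c₃ (β r : ℝ) (k q : ℕ) : ℝ :=
  (β - r) ^ k / (((q : ℝ) + 1) * (k.factorial : ℝ)) * (q : ℝ) ^ (k - 1)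

/-! Upper bound. Give each integer `t` a block of labels `[H t, H (t + 1))` and require a vertex to
take its label from the blocks between its minimum and maximum. All demands are intervals of labels,
so Hall's theorem (`card_le_card_biUnion_Ico`, `bandwidth_graphG_le`) needs only that every interval
of integers receive at least as many labels as it contains vertices. Adjacent vertices then differ
by at most the number of labels in a window of `b + 1` integers. The number of vertices in an
interval of length `x` is at most `N x = profile k w x / k!` with `w = b + 1`; `N` is convex, and
linear beyond `w`. One therefore wants a density whose increments dominate `N` and whose mass `D` on
windows of length `w` is small. `exists_periodic_increments` takes a `w`-periodic one, constant on
the segments between the points `i w` and `i w + r`, with mass `m = N (q (w - r)) / q` on the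
segments of length `w - r` and `D - m` on those of length `r`. The total mass `(q + 1) D - m` is set
equal to `N (q w + r)`, which determines `D`; convexity reduces the domination of `N` to the nodes.
Lower bound. With `c = b + 1 - k`, vertices inside `q c + 1` consecutive integers are at distance at
most `q`, so their labels span at most `q B`; counting them yields `c₁`. For the other bound,
consider the vertices with the first and last labels. If their distance exceeds `q`, they lie near
opposite ends, and every vertex inside `[ρ, b]`, where `n = ρ + q c`, is adjacent to one and within
distance `q` of the other. Those vertices fit into about `(q + 1) B - |V|` labels. The threshold on
`r` says on which side of `β` the length `q (β - r)` lies, hence which branch of the profile gives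
`m`. On the linear branch the upper constant equals `c₁`. -/

/-! ### Counting the vertices inside an interval -/

theorem mem_vertexFamily {n k b : ℕ} {X : Finset ℕ} :
    X ∈ vertexFamily n k b ↔
      (∀ x ∈ X, x ≤ n) ∧ X.card = k ∧ ∀ x ∈ X, ∀ y ∈ X, x ≤ y + b := by
  simp only [vertexFamily, Finset.mem_filter, Finset.mem_powersetCard, spread_le_iff, and_assoc,
    Finset.subset_iff, Finset.mem_range, Nat.lt_succ_iff]

/-- The `k`-subsets of spread at most `b` of the interval of `M` integers starting at `s`. -/
def windowFamily (k b s M : ℕ) : Finset (Finset ℕ) :=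
  ((Finset.Ico s (s + M)).powersetCard k).filter fun X => spread X ≤ b

theorem mem_windowFamily {k b s M : ℕ} {X : Finset ℕ} :
    X ∈ windowFamily k b s M ↔
      (∀ x ∈ X, s ≤ x ∧ x < s + M) ∧ X.card = k ∧ ∀ x ∈ X, ∀ y ∈ X, x ≤ y + b := by
  simp only [windowFamily, Finset.mem_filter, Finset.mem_powersetCard, spread_le_iff, and_assoc,
    Finset.subset_iff, Finset.mem_Ico]

theorem vertexFamily_eq_windowFamily (n k b : ℕ) :
    vertexFamily n k b = windowFamily k b 0 (n + 1) := by
  ext X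
  simp [mem_vertexFamily, mem_windowFamily]

theorem windowFamily_subset_vertexFamily {n k b s M : ℕ} (h : s + M ≤ n + 1) :
    windowFamily k b s M ⊆ vertexFamily n k b := by
  intro X hX
  rw [mem_windowFamily] at hX
  rw [mem_vertexFamily]
  exact ⟨fun x hx => by have := (hX.1 x hx).2; omega, hX.2⟩

theorem card_windowFamily_of_le {k b s M : ℕ} (h : M ≤ b + 1) :
    (windowFamily k b s M).card = M.choose k := by
  rw [windowFamily, Finset.filter_true_of_mem, Finset.card_powersetCard, Nat.card_Ico,
    Nat.add_sub_cancel_left]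
  intro X hX
  rw [Finset.mem_powersetCard] at hX
  rw [spread_le_iff]
  intro x hx y hy
  have h1 := Finset.mem_Ico.1 (hX.1 hx)
  have h2 := Finset.mem_Ico.1 (hX.1 hy)
  omega

/-- The new sets are those containing the new largest integer `s + M`; their other `k` elements are
arbitrary among the `b` integers just below it. -/
theorem card_windowFamily_succ {k b s M : ℕ} (h : b ≤ M) :
    (windowFamily (k + 1) b s (M + 1)).card
      = (windowFamily (k + 1) b s M).card + b.choose k := by
  have hI : Finset.Ico s (s + (M + 1)) = insert (s + M) (Finset.Ico s (s + M)) := by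
    ext x; simp; omega
  have hnot : s + M ∉ Finset.Ico s (s + M) := by simp
  have hsplit : windowFamily (k + 1) b s (M + 1) = windowFamily (k + 1) b s M ∪
      ((Finset.Ico (s + M - b) (s + M)).powersetCard k).image (insert (s + M)) := by
    unfold windowFamily
    rw [hI, Finset.powersetCard_succ_insert hnot, Finset.filter_union]
    congr 1
    ext X
    simp only [Finset.mem_filter, Finset.mem_image, Finset.mem_powersetCard, spread_le_iff,
      Finset.subset_iff, Finset.mem_Ico]
    constructor
    · rintro ⟨⟨Y, ⟨hY, hc⟩, rfl⟩, hs⟩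
      refine ⟨Y, ⟨fun x hx => ⟨?_, (hY hx).2⟩, hc⟩, rfl⟩
      have := hs (s + M) (Finset.mem_insert_self _ _) x (Finset.mem_insert_of_mem hx)
      omega
    · rintro ⟨Y, ⟨hY, hc⟩, rfl⟩
      refine ⟨⟨Y, ⟨fun x hx => ⟨by have := (hY hx).1; omega, (hY hx).2⟩, hc⟩, rfl⟩, ?_⟩
      intro x hx y hy
      rw [Finset.mem_insert] at hx hy
      rcases hx with rfl | hx <;> rcases hy with rfl | hy
      · omega
      · have := (hY hy).1; omega
      · have := (hY hx).2; omega
      · have := (hY hx).2; have := (hY hy).1; omega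
  rw [hsplit, Finset.card_union_of_disjoint, Finset.card_image_of_injOn,
    Finset.card_powersetCard, Nat.card_Ico]
  · congr 2
    omega
  · intro X hX Y hY hXY
    simp only [Finset.mem_coe, Finset.mem_powersetCard, Finset.subset_iff, Finset.mem_Ico] at hX hY
    have hX' : s + M ∉ X := fun h => by have := (hX.1 h).2; omega
    have hY' : s + M ∉ Y := fun h => by have := (hY.1 h).2; omega
    rw [← Finset.erase_insert hX', ← Finset.erase_insert hY']
    exact congrArg (fun Z => Finset.erase Z (s + M)) hXY
  · rw [Finset.disjoint_left]
    rintro X hX hX'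
    obtain ⟨Y, _, rfl⟩ := Finset.mem_image.1 hX'
    have := ((mem_windowFamily.1 hX).1 (s + M) (Finset.mem_insert_self _ _)).2
    omega

theorem card_windowFamily_add (k b s j : ℕ) :
    (windowFamily (k + 1) b s (b + j)).card = b.choose (k + 1) + j * b.choose k := by
  induction j with
  | zero => simp [card_windowFamily_of_le]
  | succ j ih =>
    rw [← Nat.add_assoc, card_windowFamily_succ (by omega), ih]
    ring

/-- The volume, up to the factor `k!`, of the `k`-point subsets of diameter at most `w` of an
interval of length `x`. -/
noncomputable def profile (k : ℕ) (w x : ℝ) : ℝ :=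
  min x w ^ k + k * w ^ (k - 1) * max (x - w) 0

theorem profile_of_le {k : ℕ} {w x : ℝ} (h : x ≤ w) : profile k w x = x ^ k := by
  simp [profile, min_eq_left h, max_eq_right (sub_nonpos.2 h)]

theorem profile_of_ge {k : ℕ} {w x : ℝ} (h : w ≤ x) :
    profile k w x = w ^ k + k * w ^ (k - 1) * (x - w) := by
  simp [profile, min_eq_right h, max_eq_left (sub_nonneg.2 h)]

theorem factorial_mul_choose_le (a k : ℕ) : (k.factorial : ℝ) * a.choose k ≤ (a : ℝ) ^ k := by
  have h := Nat.choose_le_pow_div (α := ℝ) k a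
  rw [le_div_iff₀ (by positivity)] at h
  linarith

theorem factorial_mul_card_windowFamily_le {k : ℕ} (hk : 1 ≤ k) (b s M : ℕ) :
    (k.factorial : ℝ) * (windowFamily k b s M).card ≤ profile k ((b + 1 : ℕ) : ℝ) M := by
  rcases le_total M (b + 1) with h | h
  · rw [card_windowFamily_of_le h, profile_of_le (by exact_mod_cast h)]
    exact factorial_mul_choose_le M k
  · obtain ⟨j, rfl⟩ := Nat.exists_eq_add_of_le h
    obtain ⟨k, rfl⟩ := Nat.exists_eq_add_of_le' hk
    rw [profile_of_ge (by exact_mod_cast h)]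
    -- Pascal's rule absorbs one of the `1 + j` extra terms. With threshold `b + 1` instead of `b`,
    -- the profile bounds the count without an error term.
    have hcard : (windowFamily (k + 1) b s (b + 1 + j)).card
        = (b + 1).choose (k + 1) + j * b.choose k := by
      rw [Nat.add_assoc, card_windowFamily_add, Nat.choose_succ_succ]
      ring
    rw [hcard]
    have h1 := factorial_mul_choose_le (b + 1) (k + 1)
    have h2 : (k.factorial : ℝ) * b.choose k ≤ ((b + 1 : ℕ) : ℝ) ^ k :=
      (factorial_mul_choose_le b k).trans (pow_le_pow_left₀ (by positivity) (by simp) k)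
    have h3 : ((k + 1).factorial : ℝ) * (j * b.choose k)
        ≤ ((k + 1 : ℕ) : ℝ) * ((b + 1 : ℕ) : ℝ) ^ k * j := by
      rw [Nat.factorial_succ]
      push_cast at h2 ⊢
      calc ((k : ℝ) + 1) * k.factorial * (j * b.choose k)
          = ((k : ℝ) + 1) * j * (k.factorial * b.choose k) := by ring
        _ ≤ ((k : ℝ) + 1) * j * ((b : ℝ) + 1) ^ k := by gcongr
        _ = _ := by ring
    push_cast at h1 h3 ⊢
    simp only [add_sub_cancel_left]
    linarith

/-! ### Numberings with gaps and Hall's theorem for intervals -/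

theorem numberingBandwidth_le_iff {V : Type*} [Fintype V] (G : SimpleGraph V)
    (f : V ≃ Fin (Fintype.card V)) (B : ℕ) :
    numberingBandwidth G f ≤ B ↔
      ∀ u v, G.Adj u v → (((f u : ℕ) : ℤ) - ((f v : ℕ) : ℤ)).natAbs ≤ B := by
  simp [numberingBandwidth, Finset.sup_le_iff]

theorem exists_numberingBandwidth_eq {V : Type*} [Fintype V] (G : SimpleGraph V) :
    ∃ f, numberingBandwidth G f = bandwidth G := by
  have : Nonempty (V ≃ Fin (Fintype.card V)) := ⟨Fintype.equivFin V⟩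
  exact Nat.sInf_mem (Set.range_nonempty _)

/-- A numbering with gaps bounds the bandwidth. -/
theorem bandwidth_le_of_injective {V : Type*} [Fintype V] (G : SimpleGraph V) (g : V → ℕ)
    (hg : Function.Injective g) (B : ℕ) (hB : ∀ u v, G.Adj u v → g u ≤ g v + B) :
    bandwidth G ≤ B := by
  classical
  -- Closing the gaps: each vertex is relabelled by its rank under `g`, which does not increase
  -- differences.
  let below : V → Finset V := fun v => Finset.univ.filter fun u => g u < g v
  have hlt : ∀ v, (below v).card < Fintype.card V := fun v => by
    rw [← Finset.card_univ]
    refine Finset.card_lt_card ⟨Finset.subset_univ _, fun h => ?_⟩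
    have := h (Finset.mem_univ v)
    simp [below] at this
  have hmono : ∀ u v, g u < g v → (below u).card < (below v).card := fun u v h => by
    refine Finset.card_lt_card ⟨fun z hz => ?_, fun hsub => ?_⟩
    · simp only [below, Finset.mem_filter, Finset.mem_univ, true_and] at hz ⊢
      omega
    · have : u ∈ below u := hsub (by simpa [below] using h)
      simp [below] at this
  have hinj : Function.Injective fun v => (⟨(below v).card, hlt v⟩ : Fin (Fintype.card V)) := by
    intro u v huv
    have huv' : (below u).card = (below v).card := congrArg Fin.val huv
    rcases lt_trichotomy (g u) (g v) with h | h | h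
    · have := hmono u v h; omega
    · exact hg h
    · have := hmono v u h; omega
  have hdiff : ∀ u v, g u ≤ g v + B → (below u).card ≤ (below v).card + B := fun u v h => by
    have hsub : below u ⊆ below v ∪ (below u \ below v) := by
      intro z hz; by_cases hz' : z ∈ below v <;> simp [hz, hz']
    have h2 : (below u \ below v).card ≤ B := by
      have : (below u \ below v).card ≤ (Finset.Ico (g v) (g v + B)).card := by
        refine Finset.card_le_card_of_injOn g (fun z hz => ?_) (fun _ _ _ _ h => hg h)
        simp only [below, Finset.coe_sdiff, Set.mem_sdiff, Finset.mem_coe, Finset.mem_filter, Finset.mem_univ,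
          true_and, not_lt, Finset.coe_Ico, Set.mem_Ico] at hz ⊢
        omega
      simpa using this
    exact (Finset.card_le_card hsub).trans ((Finset.card_union_le _ _).trans (by omega))
  let f : V ≃ Fin (Fintype.card V) := Equiv.ofBijective _
    ((Fintype.bijective_iff_injective_and_card _).2 ⟨hinj, by simp⟩)
  refine (Nat.sInf_le ⟨f, rfl⟩ : bandwidth G ≤ numberingBandwidth G f).trans ?_
  rw [numberingBandwidth_le_iff]
  intro u v huv
  have h1 := hdiff u v (hB u v huv)
  have h2 := hdiff v u (hB v u huv.symm)
  change ((((below u).card : ℕ) : ℤ) - (((below v).card : ℕ) : ℤ)).natAbs ≤ B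
  omega

/-- Hall's condition for intervals of integers only needs to be checked on intervals. -/
theorem card_le_card_biUnion_Ico {ι : Type*} [DecidableEq ι] (l u : ι → ℕ)
    (S : Finset ι)
    (h : ∀ s t, s ≤ t → (S.filter fun i => s ≤ l i ∧ u i ≤ t).card ≤ t - s) :
    S.card ≤ (S.biUnion fun i => Finset.Ico (l i) (u i)).card := by
  induction hn : S.card using Nat.strong_induction_on generalizing S with
  | _ n ih =>
  subst hn
  rcases S.eq_empty_or_nonempty with rfl | hS
  · simp
  set U := S.biUnion fun i => Finset.Ico (l i) (u i) with hU
  have memU : ∀ x, x ∈ U ↔ ∃ i ∈ S, l i ≤ x ∧ x < u i := by simp [hU]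
  obtain ⟨i₀, hi₀, hmin⟩ := S.exists_min_image l hS
  -- The first uncovered point `t` from the leftmost endpoint on separates the family: each interval
  -- ends by `t` or starts after it. The first group covers all of `[l i₀, t)`, and induction treats
  -- the second.
  have hex : ∃ t, l i₀ ≤ t ∧ t ∉ U := by
    refine ⟨l i₀ + (U.sup id + 1), by omega, fun ht => ?_⟩
    have : l i₀ + (U.sup id + 1) ≤ U.sup id := Finset.le_sup (f := id) ht
    omega
  classical
  set t := Nat.find hex with ht
  obtain ⟨ht1, ht2⟩ := Nat.find_spec hex
  rw [← ht] at ht1 ht2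
  have hIn : ∀ x, l i₀ ≤ x → x < t → x ∈ U := fun x hx hxt => by
    have := Nat.find_min hex hxt
    push Not at this
    exact this hx
  have hcases : ∀ i ∈ S, u i ≤ t ∨ t < l i := fun i hi => by
    by_contra hcon
    push Not at hcon
    exact ht2 ((memU t).2 ⟨i, hi, hcon.2, hcon.1⟩)
  set S₁ := S.filter fun i => u i ≤ t with hS₁
  set S₂ := S.filter fun i => ¬ u i ≤ t with hS₂
  have hcard : S₁.card + S₂.card = S.card := Finset.card_filter_add_card_filter_not _
  have hi₀t : u i₀ ≤ t := (hcases i₀ hi₀).resolve_right (by omega)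
  have hS₁pos : 0 < S₁.card := Finset.card_pos.2 ⟨i₀, by simp [hS₁, hi₀, hi₀t]⟩
  have h1 : S₁.card ≤ t - l i₀ := by
    refine le_trans (Finset.card_le_card fun i hi => ?_) (h (l i₀) t ht1)
    simp only [hS₁, Finset.mem_filter] at hi ⊢
    exact ⟨hi.1, hmin i hi.1, hi.2⟩
  have h2 := ih S₂.card (by omega) S₂ (fun s t' hst =>
    (Finset.card_le_card (Finset.filter_subset_filter _ (Finset.filter_subset _ _))).trans
      (h s t' hst)) rfl
  have hdisj : Disjoint (Finset.Ico (l i₀) t)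
      (S₂.biUnion fun i => Finset.Ico (l i) (u i)) := by
    rw [Finset.disjoint_left]
    intro x hx hx'
    simp only [Finset.mem_biUnion, Finset.mem_Ico, hS₂, Finset.mem_filter] at hx hx'
    obtain ⟨i, ⟨hi, hit⟩, hix⟩ := hx'
    have := (hcases i hi).resolve_left hit
    omega
  have hsub : Finset.Ico (l i₀) t ∪ (S₂.biUnion fun i => Finset.Ico (l i) (u i)) ⊆ U := by
    refine Finset.union_subset (fun x hx => ?_)
      (Finset.biUnion_subset_biUnion_of_subset_left _ (Finset.filter_subset _ _))
    rw [Finset.mem_Ico] at hx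
    exact hIn x hx.1 hx.2
  have h3 := Finset.card_le_card hsub
  rw [Finset.card_union_of_disjoint hdisj, Nat.card_Ico] at h3
  omega

/-- If the block `[H t, H (t + 1))` of labels is assigned to the integer `t`, and every interval
of integers receives at least as many labels as it has vertices inside, then the vertices can be
numbered in such a way that each gets a label from the blocks between its minimum and maximum. -/
theorem bandwidth_graphG_le {n k b B : ℕ} (hk : 1 ≤ k) (H : ℕ → ℕ)
    (hcount : ∀ s t, s ≤ t → t ≤ n →
      H s + (windowFamily k b s (t + 1 - s)).card ≤ H (t + 1))
    (hpos : ∀ s t, s ≤ t → t ≤ n → H s < H (t + 1))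
    (hB : ∀ s t, s ≤ t → t ≤ n → t ≤ s + b → H (t + 1) ≤ H s + B) :
    bandwidth (graphG n k b) ≤ B := by
  classical
  have hne : ∀ X : vertexFamily n k b, X.1.Nonempty := fun X => by
    rw [← Finset.card_pos, (mem_vertexFamily.1 X.2).2.1]; omega
  let lo : vertexFamily n k b → ℕ := fun X => X.1.min' (hne X)
  let hi : vertexFamily n k b → ℕ := fun X => X.1.max' (hne X)
  have hlo : ∀ X, lo X ∈ X.1 := fun X => X.1.min'_mem _
  have hhi : ∀ X, hi X ∈ X.1 := fun X => X.1.max'_mem _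
  have hlohi : ∀ X, lo X ≤ hi X := fun X => X.1.min'_le _ (hhi X)
  have hhin : ∀ X, hi X ≤ n := fun X => (mem_vertexFamily.1 X.2).1 _ (hhi X)
  have hlo_le : ∀ X : vertexFamily n k b, ∀ x ∈ X.1, lo X ≤ x := fun X x hx => X.1.min'_le x hx
  have hhi_le : ∀ X : vertexFamily n k b, ∀ x ∈ X.1, x ≤ hi X := fun X x hx => X.1.le_max' x hx
  have hHmono : ∀ s t, s ≤ t → t ≤ n + 1 → H s ≤ H t := by
    intro s t hst ht
    rcases hst.eq_or_lt with rfl | hlt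
    · rfl
    · obtain ⟨t, rfl⟩ : ∃ t', t = t' + 1 := ⟨t - 1, by omega⟩
      exact (hpos s t (by omega) (by omega)).le
  obtain ⟨g, hginj, hgmem⟩ := (Finset.all_card_le_biUnion_card_iff_exists_injective
      (fun X : vertexFamily n k b => Finset.Ico (H (lo X)) (H (hi X + 1)))).1 (by
    intro S
    refine card_le_card_biUnion_Ico (fun X => H (lo X)) (fun X => H (hi X + 1)) S ?_
    intro s t hst
    set F := S.filter fun X => s ≤ H (lo X) ∧ H (hi X + 1) ≤ t with hF
    rcases F.eq_empty_or_nonempty with hE | hE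
    · simp [hE]
    obtain ⟨X₀, hX₀, hmin⟩ := F.exists_min_image lo hE
    obtain ⟨X₁, hX₁, hmax⟩ := F.exists_max_image hi hE
    have hle : lo X₀ ≤ hi X₁ := (hlohi X₀).trans (hmax X₀ hX₀)
    have h1 := hcount (lo X₀) (hi X₁) hle (hhin X₁)
    have h2 : F.card ≤ (windowFamily k b (lo X₀) (hi X₁ + 1 - lo X₀)).card := by
      refine Finset.card_le_card_of_injOn Subtype.val (fun X hX => ?_)
        Subtype.val_injective.injOn
      rw [Finset.mem_coe, mem_windowFamily]
      refine ⟨fun x hx => ?_, (mem_vertexFamily.1 X.2).2⟩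
      have := hlo_le X x hx
      have := hhi_le X x hx
      have := hmin X hX
      have := hmax X hX
      omega
    have h3 := (Finset.mem_filter.1 hX₀).2.1
    have h4 := (Finset.mem_filter.1 hX₁).2.2
    omega)
  refine bandwidth_le_of_injective _ g hginj B fun X Y hXY => ?_
  have hsp := (spread_le_iff _ _).1 hXY.2
  have hX := Finset.mem_Ico.1 (hgmem X)
  have hY := Finset.mem_Ico.1 (hgmem Y)
  have h1 : hi X ≤ lo Y + b :=
    hsp _ (Finset.mem_union_left _ (hhi X)) _ (Finset.mem_union_right _ (hlo Y))
  rcases le_total (lo Y) (hi X) with h | h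
  · have := hB (lo Y) (hi X) h (hhin X) h1
    omega
  -- Here `X` ends no later than `Y` begins, so the block of the single integer `lo Y` already
  -- bounds the excess of the label of `X`.
  · have h5 : H (hi X + 1) ≤ H (lo Y + 1) :=
      hHmono _ _ (by omega) (by have := hlohi Y; have := hhin Y; omega)
    have h6 := hB (lo Y) (lo Y) le_rfl ((hlohi Y).trans (hhin Y)) (by omega)
    omega

/-! ### Convex functions vanishing at zero -/

section Convex

variable {N : ℝ → ℝ}

theorem convexOn_smul_le (hN : ConvexOn ℝ (Set.Ici 0) N) (h0 : N 0 = 0) {θ z : ℝ} (hθ : 0 ≤ θ)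
    (hθ1 : θ ≤ 1) (hz : 0 ≤ z) : N (θ * z) ≤ θ * N z := by
  have := hN.2 (x := z) hz (y := 0) (Set.mem_Ici.2 le_rfl) hθ (sub_nonneg.2 hθ1) (by ring)
  simpa [h0] using this

theorem convexOn_superadditive (hN : ConvexOn ℝ (Set.Ici 0) N) (h0 : N 0 = 0) {x y : ℝ}
    (hx : 0 ≤ x) (hy : 0 ≤ y) : N x + N y ≤ N (x + y) := by
  rcases (add_nonneg hx hy).eq_or_lt with h | h
  · have hx0 : x = 0 := by linarith
    have hy0 : y = 0 := by linarith
    simp [hx0, hy0, h0]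
  · have h1 := convexOn_smul_le hN h0 (θ := x / (x + y)) (z := x + y) (by positivity)
      ((div_le_one h).2 (by linarith)) h.le
    have h2 := convexOn_smul_le hN h0 (θ := y / (x + y)) (z := x + y) (by positivity)
      ((div_le_one h).2 (by linarith)) h.le
    rw [div_mul_cancel₀ _ h.ne'] at h1 h2
    have h3 : x / (x + y) * N (x + y) + y / (x + y) * N (x + y) = N (x + y) := by
      field_simp
    linarith

theorem convexOn_nsmul_le (hN : ConvexOn ℝ (Set.Ici 0) N) (h0 : N 0 = 0) (q : ℕ) {x : ℝ}
    (hx : 0 ≤ x) : q * N x ≤ N (q * x) := by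
  induction q with
  | zero => simp [h0]
  | succ q ih =>
    have := convexOn_superadditive hN h0 (x := q * x) (y := x) (by positivity) hx
    push_cast
    rw [add_one_mul, add_one_mul]
    linarith

/-- A lower bound by a convex function for the increments of a piecewise linear function only
needs to be checked at the nodes. -/
theorem convexOn_le_interpolation (hN : ConvexOn ℝ (Set.Ici 0) N) (h0 : N 0 = 0) {K : ℕ}
    {x y : ℕ → ℝ} (hx : Monotone x)
    (hxy : ∀ c c', c ≤ c' → c' ≤ K → N (x c' - x c) ≤ y c' - y c)
    {c c' : ℕ} (hc' : c' < K) {θ θ' : ℝ} (hθ : 0 ≤ θ) (hθ1 : θ ≤ 1) (hθ' : 0 ≤ θ')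
    (hθ1' : θ' ≤ 1) (hcc : c < c' ∨ c = c' ∧ θ ≤ θ') :
    N ((x c' + θ' * (x (c' + 1) - x c')) - (x c + θ * (x (c + 1) - x c))) ≤
      (y c' + θ' * (y (c' + 1) - y c')) - (y c + θ * (y (c + 1) - y c)) := by
  rcases hcc with hcc | ⟨rfl, hle⟩
  -- Convexity is used in one endpoint at a time: `key` frees the left endpoint with the right one
  -- at a node, and then the right one is freed.
  · have key : ∀ d, c < d → d ≤ K →
        N (x d - (x c + θ * (x (c + 1) - x c))) ≤ y d - (y c + θ * (y (c + 1) - y c)) := by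
      intro d hcd hd
      have h1 := hxy c d hcd.le hd
      have h2 := hxy (c + 1) d hcd hd
      have h3 := hN.2 (x := x d - x c) (sub_nonneg.2 (hx hcd.le)) (y := x d - x (c + 1))
        (sub_nonneg.2 (hx hcd)) (sub_nonneg.2 hθ1) hθ (by ring)
      simp only [smul_eq_mul] at h3
      have e : x d - (x c + θ * (x (c + 1) - x c))
          = (1 - θ) * (x d - x c) + θ * (x d - x (c + 1)) := by ring
      rw [e]
      have h4 := mul_le_mul_of_nonneg_left h1 (sub_nonneg.2 hθ1)
      have h5 := mul_le_mul_of_nonneg_left h2 hθ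
      linarith
    have hs : x c + θ * (x (c + 1) - x c) ≤ x (c + 1) := by
      have := mul_le_mul_of_nonneg_right hθ1 (sub_nonneg.2 (hx (Nat.le_succ c)))
      simp only [Nat.succ_eq_add_one] at this
      linarith
    have h1 := key c' hcc hc'.le
    have h2 := key (c' + 1) (by omega) hc'
    set s := x c + θ * (x (c + 1) - x c)
    set v := y c + θ * (y (c + 1) - y c)
    have h3 := hN.2 (x := x c' - s) (sub_nonneg.2 (hs.trans (hx hcc))) (y := x (c' + 1) - s)
      (sub_nonneg.2 (hs.trans (hx (by omega)))) (sub_nonneg.2 hθ1') hθ' (by ring)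
    simp only [smul_eq_mul] at h3
    have e : x c' + θ' * (x (c' + 1) - x c') - s
        = (1 - θ') * (x c' - s) + θ' * (x (c' + 1) - s) := by ring
    rw [e]
    have h4 := mul_le_mul_of_nonneg_left h1 (sub_nonneg.2 hθ1')
    have h5 := mul_le_mul_of_nonneg_left h2 hθ'
    linarith
  · have h1 := convexOn_smul_le hN h0 (sub_nonneg.2 hle) (by linarith : θ' - θ ≤ 1)
      (sub_nonneg.2 (hx (Nat.le_succ c)))
    have h2 := mul_le_mul_of_nonneg_left (hxy c (c + 1) (by omega) hc') (sub_nonneg.2 hle)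
    have e : (x c + θ' * (x (c + 1) - x c)) - (x c + θ * (x (c + 1) - x c))
        = (θ' - θ) * (x (c + 1) - x c) := by ring
    rw [e]
    simp only [Nat.succ_eq_add_one] at h1
    linarith

end Convex

/-! ### The periodic density -/

/-- The sequence starting at `0` whose increments are alternately `a` and `p - a`. -/
noncomputable def alternating (p a : ℝ) (c : ℕ) : ℝ := ((c / 2 : ℕ) : ℝ) * p + ((c % 2 : ℕ) : ℝ) * a

theorem alternating_even (p a : ℝ) (i : ℕ) : alternating p a (2 * i) = i * p := by
  simp [alternating]

theorem alternating_odd (p a : ℝ) (i : ℕ) : alternating p a (2 * i + 1) = i * p + a := by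
  have h1 : (2 * i + 1) / 2 = i := by omega
  have h2 : (2 * i + 1) % 2 = 1 := by omega
  simp [alternating, h1, h2]

theorem alternating_add_two (p a : ℝ) (c : ℕ) : alternating p a (c + 2) = alternating p a c + p := by
  simp [alternating]
  ring

theorem alternating_monotone {p a : ℝ} (h0 : 0 ≤ a) (h : a ≤ p) : Monotone (alternating p a) := by
  refine monotone_nat_of_le_succ fun c => ?_
  rcases Nat.even_or_odd' c with ⟨i, rfl | rfl⟩
  · rw [alternating_odd, alternating_even]; linarith
  · rw [show 2 * i + 1 + 1 = 2 * (i + 1) by ring, alternating_odd, alternating_even]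
    push_cast; linarith

/-- The increment condition at the nodes of the optimal periodic density. -/
theorem alternating_increment {N : ℝ → ℝ} (hN : ConvexOn ℝ (Set.Ici 0) N) (h0 : N 0 = 0)
    {w r α γ : ℝ} (hr : 0 ≤ r) (hrw : r < w) (hγ : 0 ≤ γ)
    (hlow : ∀ x, 0 ≤ x → α * x - γ ≤ N x) (hlin : ∀ x, w ≤ x → N x = α * x - γ)
    {q : ℕ} (hq : 1 ≤ q) {m D : ℝ} (hm : q * m = N (q * (w - r)))
    (hD : (q + 1) * D = N (q * w + r) + m) (c c' : ℕ) (hcc : c ≤ c') (hc' : c' ≤ 2 * q + 1) :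
    N (alternating w r c' - alternating w r c)
      ≤ alternating D (D - m) c' - alternating D (D - m) c := by
  have hq' : (1 : ℝ) ≤ q := by exact_mod_cast hq
  have hq0 : (0 : ℝ) < q := by linarith
  have hw : 0 < w := hr.trans_lt hrw
  have hNt : N (q * w + r) = α * (q * w + r) - γ := hlin _ (by nlinarith)
  have hm_ge : α * (q * (w - r)) - γ ≤ q * m := hm ▸ hlow _ (by nlinarith)
  -- Superadditivity of `N` at `x` and `w`, where `N w` and `N (x + w)` are given by the linear
  -- formula.
  have hup : ∀ x, 0 ≤ x → N x ≤ α * x := fun x hx => by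
    have := convexOn_superadditive hN h0 hx hw.le
    rw [hlin w le_rfl, hlin (x + w) (by linarith)] at this
    linarith
  have hm_le : m ≤ α * (w - r) := by
    have h := hup (q * (w - r)) (by nlinarith)
    rw [← hm] at h
    refine le_of_mul_le_mul_left ?_ hq0
    linarith
  have hD_ge : α * (q * w) - γ ≤ q * D := by
    refine le_of_mul_le_mul_left ?_ (by linarith : (0 : ℝ) < q + 1)
    have : (q + 1) * (q * D) = q * N (q * w + r) + q * m := by
      rw [← mul_left_comm, hD]; ring
    rw [this, hNt]
    nlinarith
  have hD_le : D ≤ α * w := by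
    refine le_of_mul_le_mul_left ?_ (by linarith : (0 : ℝ) < q + 1)
    rw [hD, hNt]
    nlinarith
  have hfull : ∀ p : ℕ, p ≤ q → N (p * w) ≤ p * D := by
    intro p hp
    rcases Nat.eq_zero_or_pos p with rfl | hp0
    · simp [h0]
    · have hp1 : (1 : ℝ) ≤ p := by exact_mod_cast hp0
      have hpq : (p : ℝ) ≤ q := by exact_mod_cast hp
      rw [hlin _ (by nlinarith)]
      nlinarith
  have hAA : ∀ p : ℕ, p ≤ q → N (p * w + r) ≤ p * D + (D - m) := by
    intro p hp
    have hpq : (p : ℝ) ≤ q := by exact_mod_cast hp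
    rcases Nat.eq_zero_or_pos p with rfl | hp0
    -- Since `(q + 1) (D - m) = N (q w + r) - N (q (w - r))`, the claim follows by splitting `q w +
    -- r` into `q + 1` pieces of length `r` and one of length `q (w - r)`.
    · have h1 := convexOn_nsmul_le hN h0 (q + 1) hr
      have h2 := convexOn_superadditive hN h0 (x := ((q + 1 : ℕ) : ℝ) * r) (y := q * (w - r))
        (by positivity) (by nlinarith)
      have e : ((q + 1 : ℕ) : ℝ) * r + q * (w - r) = q * w + r := by push_cast; ring
      rw [e, ← hm] at h2
      push_cast at h1 h2
      simp only [Nat.cast_zero, zero_mul, zero_add]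
      refine le_of_mul_le_mul_left ?_ (by linarith : (0 : ℝ) < q + 1)
      nlinarith
    · have hp1 : (1 : ℝ) ≤ p := by exact_mod_cast hp0
      rw [hlin _ (by nlinarith)]
      nlinarith
  have hBB : ∀ p : ℕ, p + 1 ≤ q → N ((p + 1) * w - r) ≤ p * D + m := by
    intro p hp
    have hpq : (p : ℝ) + 1 ≤ q := by exact_mod_cast hp
    rcases Nat.eq_zero_or_pos p with rfl | hp0
    · have h1 := convexOn_nsmul_le hN h0 q (sub_nonneg.2 hrw.le)
      rw [← hm] at h1
      simpa using le_of_mul_le_mul_left h1 hq0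
    · have hp1 : (1 : ℝ) ≤ p := by exact_mod_cast hp0
      rw [hlin _ (by nlinarith)]
      -- Both `m` and `D` fall at most `γ / q` short of slope `α`; the `p + 1 ≤ q` shortfalls add up
      -- to at most `γ`.
      have h1 : α * (w - r) - γ / q ≤ m := by
        refine le_of_mul_le_mul_left ?_ hq0
        rw [mul_sub, mul_div_cancel₀ _ hq0.ne']; linarith
      have h2 : α * w - γ / q ≤ D := by
        refine le_of_mul_le_mul_left ?_ hq0
        rw [mul_sub, mul_div_cancel₀ _ hq0.ne']; linarith
      have h3 : (p + 1) * (γ / q) ≤ γ := by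
        rw [mul_div_assoc', div_le_iff₀ hq0]; nlinarith
      nlinarith
  -- By parity of the nodes, the distance is `p w`, `p w + r`, `(p + 1) w - r` or again `p w`.
  rcases Nat.even_or_odd' c with ⟨i, rfl | rfl⟩ <;>
    rcases Nat.even_or_odd' c' with ⟨j, rfl | rfl⟩
  · obtain ⟨p, rfl⟩ := Nat.exists_eq_add_of_le (by omega : i ≤ j)
    rw [alternating_even, alternating_even, alternating_even, alternating_even]
    have := hfull p (by omega)
    push_cast
    convert this using 2 <;> ring
  · obtain ⟨p, rfl⟩ := Nat.exists_eq_add_of_le (by omega : i ≤ j)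
    rw [alternating_even, alternating_even, alternating_odd, alternating_odd]
    have := hAA p (by omega)
    push_cast
    convert this using 2 <;> ring
  · obtain ⟨p, rfl⟩ := Nat.exists_eq_add_of_le (by omega : i + 1 ≤ j)
    rw [alternating_even, alternating_even, alternating_odd, alternating_odd]
    have := hBB p (by omega)
    push_cast
    convert this using 2 <;> ring
  · obtain ⟨p, rfl⟩ := Nat.exists_eq_add_of_le (by omega : i ≤ j)
    rw [alternating_odd, alternating_odd, alternating_odd, alternating_odd]
    have := hfull p (by omega)
    push_cast
    convert this using 2 <;> ring

/-- A function on `{0, …, q w + r}` whose increments dominate `N` and whose increments over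
windows of length `w` are constant. -/
theorem exists_periodic_increments {N : ℝ → ℝ} (hN : ConvexOn ℝ (Set.Ici 0) N) (h0 : N 0 = 0)
    {w r : ℕ} {α γ : ℝ} (hrw : r < w) (hγ : 0 ≤ γ)
    (hlow : ∀ x, 0 ≤ x → α * x - γ ≤ N x) (hlin : ∀ x, (w : ℝ) ≤ x → N x = α * x - γ)
    {q : ℕ} (hq : 1 ≤ q) :
    ∃ h : ℕ → ℝ, h 0 = 0 ∧
      (∀ s t, s ≤ t → t ≤ q * w + r → N ((t : ℝ) - s) ≤ h t - h s) ∧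
      ∀ t, h (t + w) = h t + (N (q * w + r) + N (q * (w - r)) / q) / (q + 1) := by
  have hq0 : (0 : ℝ) < q := by exact_mod_cast hq
  set m : ℝ := N (q * (w - r)) / q with hm_def
  set D : ℝ := (N (q * w + r) + m) / (q + 1) with hD_def
  have hm : q * m = N (q * (w - r)) := mul_div_cancel₀ _ hq0.ne'
  have hD : (q + 1) * D = N (q * w + r) + m := mul_div_cancel₀ _ (by positivity)
  have hrw' : (r : ℝ) < w := by exact_mod_cast hrw
  have hw0 : 0 < w := by omega
  set x : ℕ → ℝ := alternating w r with hx
  set y : ℕ → ℝ := alternating D (D - m) with hy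
  have hxm : Monotone x := alternating_monotone (by positivity) hrw'.le
  -- A point with `t % w = r` closes its short segment instead of opening the next, so `q w + r`
  -- still lies in cell `2 q`. For `r = 0` short segments are degenerate and division by zero sets
  -- `θ` to `0`.
  let cell : ℕ → ℕ := fun t => 2 * (t / w) + if t % w ≤ r then 0 else 1
  let θ : ℕ → ℝ := fun t => (t - x (cell t)) / (x (cell t + 1) - x (cell t))
  have hcast : ∀ t : ℕ, (t : ℝ) = ((t / w : ℕ) : ℝ) * w + ((t % w : ℕ) : ℝ) := fun t => by
    exact_mod_cast (Nat.div_add_mod' t w).symm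
  have hbounds : ∀ t, x (cell t) ≤ t ∧ (t : ℝ) ≤ x (cell t + 1) := by
    intro t
    simp only [cell]
    split_ifs with ht
    · rw [Nat.add_zero, hx, alternating_even, alternating_odd]
      have : ((t % w : ℕ) : ℝ) ≤ r := by exact_mod_cast ht
      have h2 : (0 : ℝ) ≤ ((t % w : ℕ) : ℝ) := by positivity
      have := hcast t
      constructor <;> linarith
    · rw [show 2 * (t / w) + 1 + 1 = 2 * (t / w + 1) by ring, hx, alternating_even,
        alternating_odd]
      have h1 : (r : ℝ) ≤ ((t % w : ℕ) : ℝ) := by exact_mod_cast (not_le.1 ht).le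
      have h2 : ((t % w : ℕ) : ℝ) ≤ w := by exact_mod_cast (Nat.mod_lt t hw0).le
      have := hcast t
      push_cast at *
      constructor <;> linarith
  have hinterp : ∀ t : ℕ, (t : ℝ) = x (cell t) + θ t * (x (cell t + 1) - x (cell t)) := by
    intro t
    rcases eq_or_ne (x (cell t + 1) - x (cell t)) 0 with h | h
    · have := hbounds t
      rw [h]; linarith
    · simp only [θ]
      rw [div_mul_cancel₀ _ h]; ring
  have hθ0 : ∀ t, 0 ≤ θ t := fun t =>
    div_nonneg (by linarith [hbounds t]) (by linarith [hbounds t])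
  have hθ1 : ∀ t, θ t ≤ 1 := fun t =>
    div_le_one_of_le₀ (by linarith [hbounds t]) (by linarith [hbounds t])
  have hcell_mono : ∀ s t, s ≤ t → cell s ≤ cell t := by
    intro s t hst
    simp only [cell]
    have h1 := Nat.div_le_div_right (c := w) hst
    rcases h1.eq_or_lt with h | h
    · have h2 := Nat.div_add_mod s w
      have h3 := Nat.div_add_mod t w
      rw [h] at h2 ⊢
      split_ifs <;> omega
    · split_ifs <;> omega
  have hcell_add : ∀ t, cell (t + w) = cell t + 2 := by
    intro t
    simp only [cell, Nat.add_div_right t hw0, Nat.add_mod_right]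
    omega
  refine ⟨fun t => y (cell t) + θ t * (y (cell t + 1) - y (cell t)), ?_, ?_, ?_⟩
  · simp [cell, θ, hx, hy, alternating]
  · intro s t hst ht
    have hct : cell t < 2 * q + 1 := by
      simp only [cell]
      have h2 := Nat.div_add_mod t w
      have h1 : t / w ≤ q := by
        rw [← Nat.lt_succ_iff, Nat.div_lt_iff_lt_mul hw0, Nat.succ_mul]; omega
      rcases h1.eq_or_lt with h | h
      · rw [h, mul_comm] at h2
        rw [if_pos (by omega), h]; omega
      · split_ifs <;> omega
    have hcs : cell s < cell t ∨ cell s = cell t ∧ θ s ≤ θ t := by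
      rcases (hcell_mono s t hst).lt_or_eq with h | h
      · exact Or.inl h
      · refine Or.inr ⟨h, ?_⟩
        simp only [θ]
        rw [h]
        have h1 := hbounds t
        have h2 : (s : ℝ) ≤ t := by exact_mod_cast hst
        have h3 : 0 ≤ x (cell t + 1) - x (cell t) := by linarith
        gcongr
    have key := convexOn_le_interpolation hN h0 hxm
      (fun c c' => alternating_increment hN h0 (by positivity) hrw' hγ hlow hlin hq hm hD c c')
      hct (hθ0 s) (hθ1 s) (hθ0 t) (hθ1 t) hcs
    rw [← hinterp s, ← hinterp t] at key
    exact key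
  · intro t
    have hθ : θ (t + w) = θ t := by
      simp only [θ, hcell_add, add_right_comm _ 2 1, hx, alternating_add_two]
      push_cast
      congr 1 <;> ring
    simp only [hθ]
    simp only [hcell_add, add_right_comm _ 2 1, hy, alternating_add_two]
    ring

/-! ### Convexity of the profile -/

theorem bernoulli_tangent (k : ℕ) {x y : ℝ} (hx : 0 ≤ x) (hy : 0 ≤ y) :
    y ^ k + k * y ^ (k - 1) * (x - y) ≤ x ^ k := by
  rcases hy.eq_or_lt with rfl | hy
  · rcases k with _ | _ | k
    · simp
    · simp
    · simpa using by positivity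
  · have hxy : 0 ≤ x / y := by positivity
    have h := one_add_mul_le_pow (a := x / y - 1) (by linarith) k
    rw [add_sub_cancel, div_pow, le_div_iff₀ (by positivity)] at h
    rcases k with _ | k
    · simp
    · refine le_trans (le_of_eq ?_) h
      simp only [Nat.add_sub_cancel]
      field_simp
      ring

/-- The profile is `x ^ k` continued beyond `w` by its tangent there, so its slope `k * min y w ^ (k
- 1)` is nondecreasing in `y`. These supporting lines give convexity without second derivatives. -/
theorem profile_ge_tangent (k : ℕ) {w x y : ℝ} (hx : 0 ≤ x) (hy : 0 ≤ y) (hw : 0 ≤ w) :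
    profile k w y + k * min y w ^ (k - 1) * (x - y) ≤ profile k w x := by
  have hpow : ∀ {y : ℝ}, 0 ≤ y → y ≤ w → y ^ (k - 1) ≤ w ^ (k - 1) := fun h1 h2 =>
    pow_le_pow_left₀ h1 h2 _
  rcases le_total x w with hxw | hxw <;> rcases le_total y w with hyw | hyw
  · rw [profile_of_le hxw, profile_of_le hyw, min_eq_left hyw]
    exact bernoulli_tangent k hx hy
  · rw [profile_of_le hxw, profile_of_ge hyw, min_eq_right hyw]
    have := bernoulli_tangent k hx hw
    linarith
  · rw [profile_of_ge hxw, profile_of_le hyw, min_eq_left hyw]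
    have h1 := bernoulli_tangent k hw hy
    have h2 := mul_le_mul_of_nonneg_right
      (mul_le_mul_of_nonneg_left (hpow hy hyw) (Nat.cast_nonneg (α := ℝ) k)) (sub_nonneg.2 hxw)
    linarith
  · rw [profile_of_ge hxw, profile_of_ge hyw, min_eq_right hyw]
    linarith

theorem convexOn_profile (k : ℕ) {w : ℝ} (hw : 0 ≤ w) :
    ConvexOn ℝ (Set.Ici 0) (profile k w) := by
  refine ⟨convex_Ici 0, fun x hx y hy a b ha hb hab => ?_⟩
  simp only [Set.mem_Ici, smul_eq_mul] at *
  have hz : 0 ≤ a * x + b * y := by positivity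
  have h1 := mul_le_mul_of_nonneg_left (profile_ge_tangent k hx hz hw) ha
  have h2 := mul_le_mul_of_nonneg_left (profile_ge_tangent k hy hz hw) hb
  set z := a * x + b * y
  set σ := (k : ℝ) * min z w ^ (k - 1)
  have h3 : a * (profile k w z + σ * (x - z)) + b * (profile k w z + σ * (y - z))
      = (a + b) * profile k w z + σ * (a * x + b * y - (a + b) * z) := by ring
  rw [hab, one_mul, one_mul, show a * x + b * y = z from rfl, sub_self, mul_zero, add_zero] at h3
  linarith

/-! ### The explicit upper bound -/

/-- The upper bound for the bandwidth. -/
theorem bandwidth_graphG_le_profile {n k b q r : ℕ} (hk : 1 ≤ k) (hq : 1 ≤ q) (hr : r < b + 1)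
    (hn : n + 1 ≤ q * (b + 1) + r) :
    (bandwidth (graphG n k b) : ℝ) ≤
      (profile k (b + 1 : ℕ) (q * (b + 1 : ℕ) + r)
        + profile k (b + 1 : ℕ) (q * ((b + 1 : ℕ) - r)) / q) / (q + 1) / k.factorial
      + (b + 2) := by
  set w := b + 1 with hw
  have hfac : (0 : ℝ) < k.factorial := by positivity
  have hw0 : (0 : ℝ) ≤ w := by positivity
  set N : ℝ → ℝ := fun x => (k.factorial : ℝ)⁻¹ * profile k w x with hN_def
  have hN : ConvexOn ℝ (Set.Ici 0) N := (convexOn_profile k hw0).smul (by positivity)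
  have hN0 : N 0 = 0 := by
    simp [hN_def, profile_of_le hw0, Nat.one_le_iff_ne_zero.1 hk]
  have hwk : (w : ℝ) ^ k = w ^ (k - 1) * w := by
    rw [← pow_succ, Nat.sub_add_cancel hk]
  have hk' : (1 : ℝ) ≤ k := by exact_mod_cast hk
  -- The line `α x - γ` is the tangent of `N` at `w`.
  obtain ⟨h, hh0, hinc, hper⟩ := exists_periodic_increments (N := N) hN hN0 (w := w) (r := r)
    (α := (k.factorial : ℝ)⁻¹ * (k * w ^ (k - 1)))
    (γ := (k.factorial : ℝ)⁻¹ * ((k - 1) * w ^ k)) hr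
    (mul_nonneg (by positivity) (mul_nonneg (by linarith) (by positivity)))
    (fun x hx => by
      have := profile_ge_tangent k (w := w) hx hw0 hw0
      rw [profile_of_le le_rfl, min_self] at this
      rw [mul_assoc, ← mul_sub]
      refine mul_le_mul_of_nonneg_left (le_trans (le_of_eq ?_) this) (by positivity)
      rw [hwk]; ring)
    (fun x hx => by
      simp only [hN_def]
      rw [profile_of_ge hx, hwk]; ring) hq
  set D := (N (q * w + r) + N (q * (w - r)) / q) / (q + 1) with hD
  have hDeq : (profile k (w : ℝ) (q * w + r) + profile k (w : ℝ) (q * (w - r)) / q) / (q + 1)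
      / k.factorial = D := by
    simp only [hD, hN_def]
    field_simp
  rw [hDeq]
  have hNnn : ∀ x, 0 ≤ x → 0 ≤ N x := fun x hx => by
    simp only [hN_def, profile]
    have : 0 ≤ min x w := le_min hx hw0
    positivity
  have hmono : ∀ s t, s ≤ t → t ≤ q * w + r → h s ≤ h t := fun s t hst ht => by
    have h1 := hinc s t hst ht
    have h2 := hNnn ((t : ℝ) - s) (sub_nonneg.2 (by exact_mod_cast hst))
    linarith
  have hhnn : ∀ t, t ≤ q * w + r → 0 ≤ h t := fun t ht => hh0 ▸ hmono 0 t (Nat.zero_le _) ht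
  have hwindow : ∀ s t, s ≤ t → t ≤ q * w + r → t ≤ s + w → h t ≤ h s + D := by
    intro s t hst ht htw
    rcases le_total w t with hwt | hwt
    · obtain ⟨u, rfl⟩ := Nat.exists_eq_add_of_le' hwt
      rw [hper]
      have := hmono u s (by omega) (hst.trans ht)
      linarith
    · have h1 := hper 0
      rw [zero_add, hh0] at h1
      have h2 := hmono t w hwt (by nlinarith)
      have h3 := hhnn s (hst.trans ht)
      linarith
  -- The summand `t` makes `H` strictly increasing. Over a window it costs at most `b + 1`, and
  -- rounding costs one more; this `b + 2` is negligible against `n ^ k` for `k ≥ 2`.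
  set H : ℕ → ℕ := fun t => ⌊h t + t⌋₊ with hH
  have hHle : ∀ t, t ≤ q * w + r → (H t : ℝ) ≤ h t + t := fun t ht =>
    Nat.floor_le (add_nonneg (hhnn t ht) (by positivity))
  have hHlt : ∀ t, h t + t < H t + 1 := fun t => Nat.lt_floor_add_one _
  have hDnn : 0 ≤ D := by
    have := hwindow 0 0 le_rfl (Nat.zero_le _) (Nat.zero_le _)
    linarith
  have hbw : bandwidth (graphG n k b) ≤ ⌊D + (b + 2)⌋₊ := by
    refine bandwidth_graphG_le hk H ?_ ?_ ?_
    · intro s t hst ht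
      have h1 := hinc s (t + 1) (by omega) (by omega)
      have h2 := factorial_mul_card_windowFamily_le hk b s (t + 1 - s)
      rw [Nat.cast_sub (by omega : s ≤ t + 1)] at h2
      have h3 : ((windowFamily k b s (t + 1 - s)).card : ℝ) ≤ N (((t + 1 : ℕ) : ℝ) - s) := by
        simp only [hN_def]
        rw [inv_mul_eq_div, le_div_iff₀ hfac]
        linarith
      have h4 := hHle s (by omega)
      have h5 := hHlt (t + 1)
      have h6 : (s : ℝ) + 1 ≤ (t + 1 : ℕ) := by exact_mod_cast Nat.succ_le_succ hst
      have : ((H s + (windowFamily k b s (t + 1 - s)).card : ℕ) : ℝ) < (H (t + 1) + 1 : ℕ) := by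
        push_cast at *
        linarith
      exact Nat.lt_succ_iff.1 (by exact_mod_cast this)
    · intro s t hst ht
      have h1 := hmono s (t + 1) (by omega) (by omega)
      have h2 : h s + s + 1 ≤ h (t + 1) + (t + 1 : ℕ) := by
        have : (s : ℝ) ≤ t := by exact_mod_cast hst
        push_cast
        linarith
      have h3 := Nat.floor_mono h2
      rw [Nat.floor_add_one (add_nonneg (hhnn s (by omega)) (by positivity))] at h3
      exact h3
    · intro s t hst ht htb
      have h1 := hwindow s (t + 1) (by omega) (by omega) (by omega)
      have h2 := hHle (t + 1) (by omega)
      have h3 := hHlt s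
      have h4 : (t : ℝ) ≤ s + b := by exact_mod_cast htb
      have h5 : (H (t + 1) : ℝ) - H s ≤ D + (b + 2) := by
        push_cast at *
        linarith
      rcases le_total (H (t + 1)) (H s) with h6 | h6
      · omega
      · rw [← Nat.cast_sub h6] at h5
        have := Nat.le_floor h5
        omega
  calc (bandwidth (graphG n k b) : ℝ) ≤ (⌊D + (b + 2)⌋₊ : ℕ) := by exact_mod_cast hbw
    _ ≤ D + (b + 2) := Nat.floor_le (by positivity)

/-! ### Lower bounds from distances in the graph -/

theorem graphG_adj_or_eq {n k b : ℕ} {X Y : vertexFamily n k b} (s : ℕ)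
    (hX : ∀ x ∈ X.1, s ≤ x ∧ x ≤ s + b) (hY : ∀ y ∈ Y.1, s ≤ y ∧ y ≤ s + b) :
    X = Y ∨ (graphG n k b).Adj X Y := by
  refine or_iff_not_imp_left.2 fun hne => ⟨hne, (spread_le_iff _ _).2 fun x hx y hy => ?_⟩
  have h : ∀ z ∈ X.1 ∪ Y.1, s ≤ z ∧ z ≤ s + b := fun z hz =>
    (Finset.mem_union.1 hz).elim (hX z) (hY z)
  have h1 := h x hx
  have h2 := h y hy
  omega

section Lipschitz

variable {n k b c B : ℕ}

/-- A numbering of bandwidth `B` of `G_{n,k,b}`, where `b + 1 = c + k`, changes by at most `d B` between a vertex and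
another one reaching at most `d c` to the right of its minimum. -/
theorem label_le_of_window {f : vertexFamily n k b → ℤ} (hk : 1 ≤ k)
    (hb : b + 1 = c + k)
    (hf : ∀ X Y, (graphG n k b).Adj X Y → |f X - f Y| ≤ B) (d : ℕ) :
    ∀ (s : ℕ) (X Y : vertexFamily n k b),
      (∀ x ∈ X.1, s ≤ x ∧ x ≤ s + b) → (∀ y ∈ Y.1, s ≤ y ∧ y ≤ s + (d + 1) * c) →
      |f X - f Y| ≤ (d + 1) * B := by
  have hstep : ∀ (s : ℕ) (X Y : vertexFamily n k b),
      (∀ x ∈ X.1, s ≤ x ∧ x ≤ s + b) → (∀ y ∈ Y.1, s ≤ y ∧ y ≤ s + b) →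
      |f X - f Y| ≤ B := fun s X Y hX hY => by
    rcases graphG_adj_or_eq s hX hY with rfl | h
    · simp
    · exact hf X Y h
  induction d with
  | zero =>
    intro s X Y hX hY
    have := hstep s X Y hX fun y hy => by have := hY y hy; omega
    simpa using this
  | succ d ih =>
    intro s X Y hX hY
    by_cases hnear : ∀ y ∈ Y.1, y ≤ s + b
    · have h1 := hstep s X Y hX fun y hy => ⟨(hY y hy).1, hnear y hy⟩
      push_cast
      nlinarith
    · push Not at hnear
      obtain ⟨y₁, hy₁, hlt⟩ := hnear
      have hYn := mem_vertexFamily.1 Y.2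
      obtain ⟨y₀, hy₀, hmin⟩ := Y.1.exists_min_image id ⟨y₁, hy₁⟩
      simp only [id] at hmin
      have hs₀ := (hY y₀ hy₀).1
      have hn₁ := hYn.1 y₁ hy₁
      -- The next vertex on the path is a block of `k` consecutive integers. The start `s + c` is
      -- the last one keeping it inside `[s, s + b]`; if `Y` begins earlier, the block starts with
      -- `Y` and is equal or adjacent to it.
      set s' := min (s + c) y₀ with hs'
      have hZmem : Finset.Ico s' (s' + k) ∈ vertexFamily n k b := by
        rw [mem_vertexFamily]
        refine ⟨fun x hx => ?_, by simp, fun x hx y hy => ?_⟩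
        · rw [Finset.mem_Ico] at hx; omega
        · rw [Finset.mem_Ico] at hx hy; omega
      have h1 := hstep s X ⟨_, hZmem⟩ hX fun y hy => by
        rw [Finset.mem_Ico] at hy; omega
      have hZ : ∀ x ∈ Finset.Ico s' (s' + k), s' ≤ x ∧ x ≤ s' + b := fun y hy => by
        rw [Finset.mem_Ico] at hy; omega
      have h2 : |f ⟨_, hZmem⟩ - f Y| ≤ (d + 1) * B := by
        rcases le_total (s + c) y₀ with h | h
        · refine ih s' ⟨_, hZmem⟩ Y hZ fun y hy => ?_
          have := hmin y hy
          have := (hY y hy).2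
          rw [show (d + 1 + 1) * c = (d + 1) * c + c by ring] at this
          omega
        · have h3 := hstep s' ⟨_, hZmem⟩ Y hZ fun y hy => by
            have := hmin y hy
            have := hYn.2.2 y hy y₀ hy₀
            omega
          nlinarith
      have h3 := abs_sub_le (f X) (f ⟨_, hZmem⟩) (f Y)
      push_cast
      linarith

theorem label_le_of_span {f : vertexFamily n k b → ℤ} (hk : 1 ≤ k)
    (hb : b + 1 = c + k)
    (hf : ∀ X Y, (graphG n k b).Adj X Y → |f X - f Y| ≤ B) {q : ℕ} (hq : 1 ≤ q)
    (X Y : vertexFamily n k b) (hXY : ∀ x ∈ X.1, ∀ y ∈ Y.1, x ≤ y + q * c)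
    (hYX : ∀ y ∈ Y.1, ∀ x ∈ X.1, y ≤ x + q * c) : |f X - f Y| ≤ q * B := by
  obtain ⟨d, rfl⟩ := Nat.exists_eq_add_of_le' hq
  have hX := mem_vertexFamily.1 X.2
  have hY := mem_vertexFamily.1 Y.2
  obtain ⟨x₀, hx₀, hxmin⟩ := X.1.exists_min_image id (Finset.card_pos.1 (by omega))
  obtain ⟨y₀, hy₀, hymin⟩ := Y.1.exists_min_image id (Finset.card_pos.1 (by omega))
  simp only [id] at hxmin hymin
  rcases le_total x₀ y₀ with h | h
  · have := label_le_of_window hk hb hf d x₀ X Y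
      (fun x hx => ⟨hxmin x hx, hX.2.2 x hx x₀ hx₀⟩)
      (fun y hy => ⟨h.trans (hymin y hy), hYX y hy x₀ hx₀⟩)
    exact_mod_cast this
  · have := label_le_of_window hk hb hf d y₀ Y X
      (fun y hy => ⟨hymin y hy, hY.2.2 y hy y₀ hy₀⟩)
      (fun x hx => ⟨h.trans (hxmin x hx), hXY x hx y₀ hy₀⟩)
    rw [abs_sub_comm] at this
    exact_mod_cast this

end Lipschitz

theorem exists_optimal_labels {V : Type*} [Fintype V] (G : SimpleGraph V) :
    ∃ f : V ≃ Fin (Fintype.card V), ∀ u v, G.Adj u v →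
      |((f u : ℕ) : ℤ) - ((f v : ℕ) : ℤ)| ≤ bandwidth G := by
  obtain ⟨f, hf⟩ := exists_numberingBandwidth_eq G
  refine ⟨f, fun u v huv => ?_⟩
  have := (numberingBandwidth_le_iff G f _).1 hf.le u v huv
  rw [Int.abs_eq_natAbs]
  exact_mod_cast this

theorem card_le_of_labels_mem_Icc {V ι : Type*} (S : Finset ι) (e : ι → V) (g : V → ℤ)
    (he : Set.InjOn e S) (hg : Function.Injective g) (l u : ℤ)
    (h : ∀ i ∈ S, l ≤ g (e i) ∧ g (e i) ≤ u) : (S.card : ℤ) ≤ max (u + 1 - l) 0 := by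
  have h1 : S.card ≤ (Finset.Icc l u).card :=
    Finset.card_le_card_of_injOn (fun i => g (e i))
      (fun i hi => by simpa using h i hi) (fun i hi j hj hij => he hi hj (hg hij))
  rw [Int.card_Icc] at h1
  omega

/-- Any two of these vertices are at distance at most `q`, so their distinct labels lie among `q B +
1` consecutive integers. -/
theorem card_windowFamily_le_bandwidth {n k b c q M : ℕ} (hk : 1 ≤ k) (hq : 1 ≤ q)
    (hb : b + 1 = c + k)
    (hM : M ≤ n + 1) (hMq : M ≤ q * c + 1) :
    (windowFamily k b 0 M).card ≤ q * bandwidth (graphG n k b) + 1 := by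
  obtain ⟨f, hf⟩ := exists_optimal_labels (graphG n k b)
  generalize bandwidth (graphG n k b) = B at hf ⊢
  set g : vertexFamily n k b → ℤ := fun X => ((f X : ℕ) : ℤ) with hg
  have hginj : Function.Injective g := fun X Y h =>
    f.injective (Fin.ext (by simpa [hg] using h))
  set S : Finset (vertexFamily n k b) :=
    Finset.univ.filter fun X => X.1 ∈ windowFamily k b 0 M with hS
  have hcard : S.card = (windowFamily k b 0 M).card := by
    refine Finset.card_bij (fun X _ => X.1) (fun X hX => (Finset.mem_filter.1 hX).2)
      (fun X _ Y _ h => Subtype.ext h) fun X hX =>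
        ⟨⟨X, windowFamily_subset_vertexFamily (by omega) hX⟩, by simpa [hS] using hX, rfl⟩
  rw [← hcard]
  rcases S.eq_empty_or_nonempty with hE | hE
  · simp [hE]
  obtain ⟨X₀, hX₀, hmin⟩ := S.exists_min_image g hE
  have hlab : ∀ X ∈ S, g X ≤ g X₀ + q * B := by
    intro X hX
    have h1 := (mem_windowFamily.1 (Finset.mem_filter.1 hX).2).1
    have h2 := (mem_windowFamily.1 (Finset.mem_filter.1 hX₀).2).1
    have := label_le_of_span (f := g) hk hb hf hq X X₀
      (fun x hx y hy => by have := h1 x hx; omega)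
      (fun y hy x hx => by have := h2 y hy; omega)
    have := le_abs_self (g X - g X₀)
    omega
  have := card_le_of_labels_mem_Icc S id g (fun _ _ _ _ h => h) hginj (g X₀) (g X₀ + q * B)
    (fun X hX => ⟨hmin X hX, hlab X hX⟩)
  have hnn : (0 : ℤ) ≤ q * B := by positivity
  have h2 : (S.card : ℤ) ≤ q * B + 1 := this.trans (max_le (by omega) (by omega))
  exact_mod_cast h2

/-- Either the first and the last vertex of an optimal numbering are at distance at most `q`, or
all vertices in `[ρ, b]` are adjacent to one of them and at distance at most `q` from the other. -/
theorem card_vertexFamily_add_le_bandwidth {n k b c q ρ : ℕ} (hk : 1 ≤ k) (hq : 1 ≤ q)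
    (hb : b + 1 = c + k) (hn : n = ρ + q * c)
    (hρ : ρ ≤ c) (hbq : b ≤ q * c) :
    (vertexFamily n k b).card ≤ q * bandwidth (graphG n k b) + 1 ∨
    (vertexFamily n k b).card +
        (windowFamily k b ρ (c + k - ρ)).card ≤
      (q + 1) * bandwidth (graphG n k b) + 2 := by
  obtain ⟨f, hf⟩ := exists_optimal_labels (graphG n k b)
  generalize bandwidth (graphG n k b) = B at hf ⊢
  set g : vertexFamily n k b → ℤ := fun X => ((f X : ℕ) : ℤ) with hg
  have hginj : Function.Injective g := fun X Y h =>
    f.injective (Fin.ext (by simpa [hg] using h))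
  have hVcard : Fintype.card (vertexFamily n k b) = (vertexFamily n k b).card :=
    Fintype.card_coe _
  set T := windowFamily k b ρ (c + k - ρ) with hT
  rcases Nat.eq_zero_or_pos (vertexFamily n k b).card with h0 | hpos
  · left; omega
  set v := (vertexFamily n k b).card with hv
  obtain ⟨X₀, hX₀⟩ := f.surjective ⟨0, by omega⟩
  obtain ⟨X₁, hX₁⟩ := f.surjective ⟨v - 1, by omega⟩
  have hg0 : g X₀ = 0 := by simp [hg, hX₀]
  have hg1 : g X₁ = v - 1 := by
    simp only [hg, hX₁]
    omega
  by_cases hdist : (∀ x ∈ X₀.1, ∀ y ∈ X₁.1, x ≤ y + q * c) ∧ ∀ y ∈ X₁.1, ∀ x ∈ X₀.1, y ≤ x + q * c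
  · left
    have h1 := label_le_of_span (f := g) hk hb hf hq X₀ X₁ hdist.1 hdist.2
    rw [hg0, hg1, abs_sub_comm] at h1
    have h2 := le_abs_self ((v : ℤ) - 1 - 0)
    have h3 : (v : ℤ) ≤ q * B + 1 := by linarith
    exact_mod_cast h3
  right
  have hTmem : ∀ Z ∈ T, Z ∈ vertexFamily n k b ∧ ∀ z ∈ Z, ρ ≤ z ∧ z ≤ b := by
    intro Z hZ
    have h1 := mem_windowFamily.1 hZ
    have h2 : ∀ z ∈ Z, ρ ≤ z ∧ z ≤ b := fun z hz => by
      have := h1.1 z hz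
      omega
    refine ⟨mem_vertexFamily.2 ⟨fun z hz => ?_, h1.2⟩, h2⟩
    have := h2 z hz
    omega
  -- Nonemptiness excludes the value `0` of the maximum in `card_le_of_labels_mem_Icc`.
  have hTpos : 0 < T.card := by
    rw [hT, card_windowFamily_of_le (by omega)]
    exact Nat.choose_pos (by omega)
  have hTle : ∀ l u : ℤ,
      (∀ Z (hZ : Z ∈ T), l ≤ g ⟨Z, (hTmem Z hZ).1⟩ ∧ g ⟨Z, (hTmem Z hZ).1⟩ ≤ u) →
      (T.card : ℤ) ≤ u + 1 - l := by
    intro l u h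
    have := card_le_of_labels_mem_Icc T.attach
      (fun Z => (⟨Z.1, (hTmem Z.1 Z.2).1⟩ : vertexFamily n k b)) g
      (fun Z _ Z' _ h => Subtype.ext (congrArg (fun X : vertexFamily n k b => X.1) h))
      hginj l u (fun Z _ => h Z.1 Z.2)
    rw [Finset.card_attach] at this
    omega
  /- A vertex reaching far to the right of another one lies far from the left end, and the other
  one starts before `ρ`. -/
  have hside : ∀ X Y : vertexFamily n k b, ∀ x ∈ X.1, ∀ y ∈ Y.1, x + q * c < y →
      ∀ Z (hZ : Z ∈ T), |g ⟨Z, (hTmem Z hZ).1⟩ - g X| ≤ B ∧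
        |g ⟨Z, (hTmem Z hZ).1⟩ - g Y| ≤ q * B := by
    intro X Y x hx y hy hxy Z hZ
    have hZ' := hTmem Z hZ
    have hX := mem_vertexFamily.1 X.2
    have hY := mem_vertexFamily.1 Y.2
    obtain ⟨x₀, hx₀, hxmin⟩ := X.1.exists_min_image id ⟨x, hx⟩
    simp only [id] at hxmin
    have hx₀x := hxmin x hx
    have hyn := hY.1 y hy
    constructor
    · have := graphG_adj_or_eq (X := ⟨Z, hZ'.1⟩) (Y := X) x₀
        (fun z hz => by have := hZ'.2 z hz; omega)
        (fun z hz => ⟨hxmin z hz, hX.2.2 z hz x₀ hx₀⟩)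
      rcases this with h | h
      · rw [h]; simp
      · exact hf _ _ h
    · refine label_le_of_span (f := g) hk hb hf hq ⟨Z, hZ'.1⟩ Y (fun z hz w hw => ?_)
        (fun w hw z hz => ?_)
      · have := hZ'.2 z hz; omega
      · have := hZ'.2 z hz
        have := hY.1 w hw
        omega
  -- Labels within `B` of one of `0`, `v - 1` and within `q B` of the other lie in an interval with
  -- `(q + 1) B + 2 - v` integers.
  have hTcard : (v : ℤ) + T.card ≤ q * B + B + 2 := by
    rcases not_and_or.1 hdist with h | h
    · push Not at h
      obtain ⟨x, hx, y, hy, hxy⟩ := h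
      have := hTle (v - 1 - B) (q * B) fun Z hZ => by
        have h1 := hside X₁ X₀ y hy x hx hxy Z hZ
        rw [hg0, hg1, abs_le, abs_le] at h1
        constructor <;> linarith
      linarith
    · push Not at h
      obtain ⟨y, hy, x, hx, hxy⟩ := h
      have := hTle (v - 1 - q * B) B fun Z hZ => by
        have h1 := hside X₀ X₁ x hx y hy hxy Z hZ
        rw [hg0, hg1, abs_le, abs_le] at h1
        constructor <;> linarith
      linarith
  have hcast : ((v + T.card : ℕ) : ℤ) ≤ ((q + 1) * B + 2 : ℕ) := by
    push_cast
    linarith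
  exact_mod_cast hcast

/-! ### Passage to the limit -/

section Limits

open Topology

theorem tendsto_inv_natCast_pow {k : ℕ} (hk : 1 ≤ k) (a : ℝ) :
    Tendsto (fun n : ℕ => a / (n : ℝ) ^ k) atTop (𝓝 0) :=
  tendsto_const_nhds.div_atTop
    ((tendsto_pow_atTop (by omega : k ≠ 0)).comp tendsto_natCast_atTop_atTop)

theorem tendsto_const_div_natCast (a : ℝ) :
    Tendsto (fun n : ℕ => a / (n : ℝ)) atTop (𝓝 0) := by
  simpa using tendsto_inv_natCast_pow le_rfl a

theorem tendsto_natCast_div_self : Tendsto (fun n : ℕ => (n : ℝ) / n) atTop (𝓝 1) := by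
  refine tendsto_const_nhds.congr' ?_
  filter_upwards [eventually_gt_atTop 0] with n hn
  rw [div_self (by positivity)]

variable {a c : ℕ → ℕ} {α γ : ℝ}

theorem tendsto_add_const_div (ha : Tendsto (fun n => (a n : ℝ) / n) atTop (𝓝 α)) (d : ℕ) :
    Tendsto (fun n => ((a n + d : ℕ) : ℝ) / n) atTop (𝓝 α) := by
  simpa [add_div] using ha.add (tendsto_const_div_natCast d)

theorem tendsto_const_mul_div (ha : Tendsto (fun n => (a n : ℝ) / n) atTop (𝓝 α)) (d : ℕ) :
    Tendsto (fun n => ((d * a n : ℕ) : ℝ) / n) atTop (𝓝 (d * α)) := by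
  simpa [mul_div_assoc] using ha.const_mul (d : ℝ)

theorem tendsto_sub_div (ha : Tendsto (fun n => (a n : ℝ) / n) atTop (𝓝 α))
    (hc : Tendsto (fun n => (c n : ℝ) / n) atTop (𝓝 γ)) :
    Tendsto (fun n => ((a n - c n : ℕ) : ℝ) / n) atTop (𝓝 (max (α - γ) 0)) := by
  refine ((ha.sub hc).max (tendsto_const_nhds (x := (0 : ℝ)))).congr fun n => ?_
  rcases le_total (c n) (a n) with h | h
  · have h' : (c n : ℝ) ≤ a n := by exact_mod_cast h
    rw [Nat.cast_sub h, sub_div, max_eq_left]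
    rw [← sub_div]
    exact div_nonneg (sub_nonneg.2 h') (by positivity)
  · have h' : (a n : ℝ) ≤ c n := by exact_mod_cast h
    rw [Nat.sub_eq_zero_of_le h, ← sub_div, max_eq_right]
    · simp
    · exact div_nonpos_of_nonpos_of_nonneg (sub_nonpos.2 h') (by positivity)

theorem tendsto_sub_const_div (ha : Tendsto (fun n => (a n : ℝ) / n) atTop (𝓝 α)) (hα : 0 ≤ α)
    (d : ℕ) : Tendsto (fun n => ((a n - d : ℕ) : ℝ) / n) atTop (𝓝 α) := by
  simpa [max_eq_left hα] using tendsto_sub_div ha (tendsto_const_div_natCast d)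

theorem tendsto_min_div (ha : Tendsto (fun n => (a n : ℝ) / n) atTop (𝓝 α))
    (hc : Tendsto (fun n => (c n : ℝ) / n) atTop (𝓝 γ)) :
    Tendsto (fun n => ((min (a n) (c n) : ℕ) : ℝ) / n) atTop (𝓝 (min α γ)) := by
  refine (ha.min hc).congr fun n => ?_
  rw [Nat.cast_min, min_div_div_right (by positivity)]

theorem eventually_lt_of_tendsto_div (ha : Tendsto (fun n => (a n : ℝ) / n) atTop (𝓝 α))
    (hc : Tendsto (fun n => (c n : ℝ) / n) atTop (𝓝 γ)) (h : α < γ) :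
    ∀ᶠ n in atTop, a n < c n := by
  filter_upwards [ha.eventually_lt hc h, eventually_gt_atTop 0] with n hn hn0
  rw [div_lt_div_iff_of_pos_right (by positivity)] at hn
  exact_mod_cast hn

theorem tendsto_choose_div (ha : Tendsto (fun n => (a n : ℝ) / n) atTop (𝓝 α)) (hα : 0 ≤ α)
    (k : ℕ) :
    Tendsto (fun n => ((a n).choose k : ℝ) / (n : ℝ) ^ k) atTop (𝓝 (α ^ k / k.factorial)) := by
  induction k with
  | zero => simp
  | succ k ih =>
    have h := (ih.mul (tendsto_sub_const_div ha hα k)).div_const ((k : ℝ) + 1)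
    have e : α ^ (k + 1) / ((k + 1).factorial : ℝ) = α ^ k / k.factorial * α / (k + 1) := by
      rw [Nat.factorial_succ]
      push_cast
      field_simp
      ring
    rw [e]
    refine h.congr fun n => ?_
    have h2 : ((a n).choose (k + 1) : ℝ) * (k + 1) = (a n).choose k * ((a n - k : ℕ) : ℝ) := by
      exact_mod_cast Nat.choose_succ_right_eq (a n) k
    rw [div_eq_iff (by positivity), div_mul_div_comm, ← h2, pow_succ]
    ring

theorem tendsto_window_count_div {j : ℕ → ℕ} {δ : ℝ}
    (ha : Tendsto (fun n => (a n : ℝ) / n) atTop (𝓝 α)) (hα : 0 ≤ α)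
    (hj : Tendsto (fun n => (j n : ℝ) / n) atTop (𝓝 δ)) (k : ℕ) :
    Tendsto (fun n => (((a n).choose (k + 1) + j n * (a n).choose k : ℕ) : ℝ) / (n : ℝ) ^ (k + 1))
      atTop (𝓝 (α ^ (k + 1) / (k + 1).factorial + δ * (α ^ k / k.factorial))) := by
  refine ((tendsto_choose_div ha hα (k + 1)).add (hj.mul (tendsto_choose_div ha hα k))).congr
    fun n => ?_
  push_cast
  rw [add_div, div_mul_div_comm, pow_succ']

theorem tendsto_profile {w x : ℕ → ℝ} (k : ℕ) (hw : Tendsto w atTop (𝓝 α))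
    (hx : Tendsto x atTop (𝓝 γ)) :
    Tendsto (fun n => profile k (w n) (x n)) atTop (𝓝 (profile k α γ)) :=
  ((hx.min hw).pow k).add
    (((hw.pow (k - 1)).const_mul (k : ℝ)).mul ((hx.sub hw).max tendsto_const_nhds))

theorem profile_div {k : ℕ} (hk : 1 ≤ k) {w x t : ℝ} (ht : 0 < t) :
    profile k w x / t ^ k = profile k (w / t) (x / t) := by
  obtain ⟨k, rfl⟩ := Nat.exists_eq_add_of_le' hk
  have h : max (x / t - w / t) 0 = max (x - w) 0 / t := by
    rw [← sub_div, ← max_div_div_right ht.le, zero_div]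
  rw [profile, profile, h, min_div_div_right ht.le, div_pow, Nat.add_sub_cancel, div_pow, pow_succ t]
  field_simp

/-- The leading coefficient of the upper bound. -/
noncomputable def upperCoeff (β r : ℝ) (k q : ℕ) : ℝ :=
  (profile k β (q * β + r) + profile k β (q * (β - r)) / q) / (q + 1) / k.factorial

theorem exists_upper_bound {k q : ℕ} (hk : 2 ≤ k) (hq : 1 ≤ q) {β r : ℝ} (hr : 0 ≤ r)
    (hrβ : r < β) (hqr : 1 = q * β + r) {b : ℕ → ℕ}
    (hb : Tendsto (fun n => (b n : ℝ) / n) atTop (𝓝 β)) :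
    ∃ u : ℕ → ℝ, Tendsto u atTop (𝓝 (upperCoeff β r k q)) ∧
      ∀ᶠ n : ℕ in atTop, (bandwidth (graphG n k (b n)) : ℝ) / (n : ℝ) ^ k ≤ u n := by
  have hw := tendsto_add_const_div hb 1
  have hqw := tendsto_const_mul_div hw q
  have hn : Tendsto (fun n : ℕ => ((n + 1 : ℕ) : ℝ) / n) atTop (𝓝 1) :=
    tendsto_add_const_div (a := fun n => n) tendsto_natCast_div_self 1
  have hρ := tendsto_sub_div hn hqw
  rw [max_eq_left (by linarith), (by linarith : 1 - q * β = r)] at hρ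
  set w : ℕ → ℕ := fun n => b n + 1
  -- Truncated subtraction matters when `r = 0`: `q * w n` may exceed `n + 1`, yet `n + 1 ≤ q * w n
  -- + ρ n` always holds.
  set ρ : ℕ → ℕ := fun n => n + 1 - q * w n
  have hp1 := tendsto_profile k hw ((hw.const_mul (q : ℝ)).add hρ)
  have hp2 := tendsto_profile k hw ((hw.sub hρ).const_mul (q : ℝ))
  have hlow : Tendsto (fun n : ℕ => ((b n : ℝ) + 2) / (n : ℝ) ^ k) atTop (𝓝 0) := by
    have := (tendsto_add_const_div hb 2).mul
      (tendsto_inv_natCast_pow (by omega : 1 ≤ k - 1) 1)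
    rw [mul_zero] at this
    refine this.congr fun n => ?_
    rw [div_mul_div_comm, ← pow_succ', Nat.sub_add_cancel (by omega), mul_one]
    push_cast
    rfl
  have hmain := ((((hp1.add (hp2.div_const (q : ℝ))).div_const ((q : ℝ) + 1)).div_const
    (k.factorial : ℝ))).add hlow
  rw [add_zero] at hmain
  refine ⟨_, hmain, ?_⟩
  filter_upwards [eventually_lt_of_tendsto_div hρ hw hrβ, eventually_gt_atTop 0] with n h1 h2
  have hn0 : (0 : ℝ) < n := by exact_mod_cast h2
  have := bandwidth_graphG_le_profile (n := n) (k := k) (b := b n) (q := q) (r := ρ n) (by omega)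
    hq h1 (by simp only [ρ, w]; omega)
  refine (div_le_div_of_nonneg_right this (by positivity)).trans (le_of_eq ?_)
  have e1 := profile_div (k := k) (w := w n) (x := q * w n + ρ n) (by omega) hn0
  have e2 := profile_div (k := k) (w := w n) (x := q * (w n - ρ n)) (by omega) hn0
  rw [add_div, mul_div_assoc] at e1
  rw [mul_div_assoc, sub_div] at e2
  rw [← e1, ← e2]
  simp only [w]
  field_simp

theorem exists_lower_bound {k q : ℕ} (hq : 2 ≤ q) {β r : ℝ} (hr : 0 ≤ r)
    (hrβ : r < β) (hqr : 1 = q * β + r) {b : ℕ → ℕ}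
    (hb : Tendsto (fun n => (b n : ℝ) / n) atTop (𝓝 β)) :
    ∃ l : ℕ → ℝ, Tendsto l atTop (𝓝 (c₁ β (k + 1) q)) ∧
      ∀ᶠ n : ℕ in atTop, l n ≤ (bandwidth (graphG n (k + 1) (b n)) : ℝ) / (n : ℝ) ^ (k + 1) := by
  have hβ : 0 < β := hr.trans_lt hrβ
  have hq' : (2 : ℝ) ≤ q := by exact_mod_cast hq
  have hc := tendsto_sub_const_div hb hβ.le k
  have hM := tendsto_add_const_div
    (tendsto_min_div (a := fun n => n) tendsto_natCast_div_self (tendsto_const_mul_div hc q)) 1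
  rw [min_eq_right (by linarith)] at hM
  -- The longest initial interval allowed by the distance bound; the minimum with `n` is needed
  -- because `q * (b n - k)` may exceed `n` when `r = 0`.
  set M : ℕ → ℕ := fun n => min n (q * (b n - k)) + 1 with hM_def
  have hj := tendsto_sub_div hM hb
  rw [max_eq_left (by nlinarith)] at hj
  have hmain := ((tendsto_window_count_div hb hβ.le hj k).sub
    (tendsto_inv_natCast_pow (by omega : 1 ≤ k + 1) 1)).div_const (q : ℝ)
  have e : (β ^ (k + 1) / ((k + 1).factorial : ℝ) + (q * β - β) * (β ^ k / k.factorial) - 0) / q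
      = c₁ β (k + 1) q := by
    rw [c₁, Nat.factorial_succ]
    push_cast
    field_simp
    ring
  rw [e] at hmain
  refine ⟨_, hmain, ?_⟩
  have hk : ∀ᶠ n : ℕ in atTop, k < b n :=
    eventually_lt_of_tendsto_div (a := fun _ => k) (tendsto_const_div_natCast k) hb hβ
  filter_upwards [eventually_lt_of_tendsto_div hb hM (by nlinarith), hk,
    eventually_gt_atTop 0] with n h1 h2 h3
  have hn0 : (0 : ℝ) < n := by exact_mod_cast h3
  have h4 := card_windowFamily_le_bandwidth (n := n) (k := k + 1) (b := b n) (c := b n - k) (q := q)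
    (M := b n + (M n - b n)) (by omega) (by omega) (by omega) (by simp only [hM_def] at *; omega)
    (by simp only [hM_def] at *; omega)
  rw [card_windowFamily_add] at h4
  have h5 : (((b n).choose (k + 1) + (M n - b n) * (b n).choose k : ℕ) : ℝ)
      ≤ q * bandwidth (graphG n (k + 1) (b n)) + 1 := by exact_mod_cast h4
  rw [← sub_div, div_div, div_le_div_iff₀ (by positivity) (by positivity)]
  have hpow : (0 : ℝ) < (n : ℝ) ^ (k + 1) := by positivity
  nlinarith

/-- Positivity of `r` gives `q (b - k) < n` eventually, so `n = ρ + q c` holds without truncation.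
The two alternatives of `card_vertexFamily_add_le_bandwidth` become a minimum. -/
theorem exists_lower_bound_of_pos {k q : ℕ} (hq : 2 ≤ q) {β r : ℝ} (hr : 0 < r)
    (hrβ : r < β) (hqr : 1 = q * β + r) {b : ℕ → ℕ}
    (hb : Tendsto (fun n => (b n : ℝ) / n) atTop (𝓝 β)) :
    ∃ l : ℕ → ℝ,
      Tendsto l atTop (𝓝 (c₂ β (k + 1) q + 1 / (q : ℝ) ^ k * c₃ β r (k + 1) q)) ∧
      ∀ᶠ n : ℕ in atTop, l n ≤ (bandwidth (graphG n (k + 1) (b n)) : ℝ) / (n : ℝ) ^ (k + 1) := by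
  have hβ : 0 < β := hr.trans hrβ
  have hq' : (2 : ℝ) ≤ q := by exact_mod_cast hq
  have hβ1 : q * β < 1 := by linarith
  have hc := tendsto_sub_const_div hb hβ.le k
  have hqc := tendsto_const_mul_div hc q
  have hid : Tendsto (fun n : ℕ => (((fun n => n) n : ℕ) : ℝ) / n) atTop (𝓝 1) :=
    tendsto_natCast_div_self
  have hρ := tendsto_sub_div hid hqc
  rw [max_eq_left (by linarith), (by linarith : 1 - q * β = r)] at hρ
  have hT := tendsto_sub_div (tendsto_add_const_div hc (k + 1)) hρ
  rw [max_eq_left (by linarith)] at hT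
  have hj := tendsto_sub_div (tendsto_add_const_div hid 1) hb
  rw [max_eq_left (by nlinarith)] at hj
  have hV := tendsto_window_count_div hb hβ.le hj k
  have hT' := tendsto_choose_div hT (by linarith) (k + 1)
  have hz := tendsto_inv_natCast_pow (by omega : 1 ≤ k + 1)
  have hmain := ((hV.sub (hz 1)).div_const (q : ℝ)).min
    (((hV.add hT').sub (hz 2)).div_const ((q : ℝ) + 1))
  have hfac : ((k + 1).factorial : ℝ) = (k + 1) * k.factorial := by
    rw [Nat.factorial_succ]; push_cast; ring
  have hfac0 : (0 : ℝ) < k.factorial := by positivity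
  have e : min ((β ^ (k + 1) / ((k + 1).factorial : ℝ) + (1 - β) * (β ^ k / k.factorial) - 0) / q)
      ((β ^ (k + 1) / ((k + 1).factorial : ℝ) + (1 - β) * (β ^ k / k.factorial)
        + (β - r) ^ (k + 1) / ((k + 1).factorial : ℝ) - 0) / (q + 1))
      = c₂ β (k + 1) q + 1 / (q : ℝ) ^ k * c₃ β r (k + 1) q := by
    -- The second alternative is the weaker one, because asymptotically `q |T| ≤ |V|` for the family
    -- `T` of vertices inside `[ρ, b]`.
    rw [min_eq_right]
    · rw [c₂, c₃, hfac, Nat.add_sub_cancel]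
      push_cast
      field_simp
      ring
    · have h1 : (β - r) ^ (k + 1) ≤ β ^ (k + 1) :=
        pow_le_pow_left₀ (by linarith) (by linarith) _
      have h2 : q * (β - r) ^ (k + 1) ≤ β ^ k := by
        have : 0 < β ^ k := by positivity
        rw [pow_succ β] at h1
        nlinarith
      have h3 : q * ((β - r) ^ (k + 1) / ((k + 1).factorial : ℝ))
          ≤ β ^ (k + 1) / ((k + 1).factorial : ℝ) + (1 - β) * (β ^ k / k.factorial) := by
        have : β ^ (k + 1) / ((k + 1).factorial : ℝ) + (1 - β) * (β ^ k / k.factorial)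
            = β ^ k * (β + (1 - β) * (k + 1)) / ((k + 1).factorial : ℝ) := by
          rw [hfac]; field_simp; ring
        rw [this, mul_div_assoc']
        refine div_le_div_of_nonneg_right (h2.trans ?_) (by positivity)
        have h4 : 0 ≤ (1 - β) * k := mul_nonneg (by nlinarith) (by positivity)
        have h5 : 0 < β ^ k := by positivity
        nlinarith
      rw [div_le_div_iff₀ (by positivity) (by positivity)]
      nlinarith
  rw [e] at hmain
  refine ⟨_, hmain, ?_⟩
  have hk : ∀ᶠ n : ℕ in atTop, k < b n :=
    eventually_lt_of_tendsto_div (a := fun _ => k) (tendsto_const_div_natCast k) hb hβ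
  filter_upwards [eventually_lt_of_tendsto_div hqc hid hβ1, eventually_lt_of_tendsto_div hρ hc hrβ,
    eventually_lt_of_tendsto_div hb hqc (by nlinarith),
    eventually_lt_of_tendsto_div hb hid (by nlinarith), hk,
    eventually_gt_atTop 0] with n h1 h2 h3 h4 h5 h6
  have hn0 : (0 : ℝ) < n := by exact_mod_cast h6
  have hpow : (0 : ℝ) < (n : ℝ) ^ (k + 1) := by positivity
  have hcard := card_vertexFamily_add_le_bandwidth (n := n) (k := k + 1) (b := b n)
    (c := b n - k) (q := q) (ρ := n - q * (b n - k)) (by omega) (by omega) (by omega) (by omega)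
    h2.le h3.le
  have hVcard : (vertexFamily n (k + 1) (b n)).card
      = (b n).choose (k + 1) + (n + 1 - b n) * (b n).choose k := by
    rw [vertexFamily_eq_windowFamily, ← card_windowFamily_add (s := 0), Nat.add_sub_cancel' (by omega)]
  rw [card_windowFamily_of_le (by omega), hVcard] at hcard
  rcases hcard with h | h
  · refine (min_le_left _ _).trans ?_
    have h' : (((b n).choose (k + 1) + (n + 1 - b n) * (b n).choose k : ℕ) : ℝ)
      ≤ q * bandwidth (graphG n (k + 1) (b n)) + 1 := by exact_mod_cast h
    rw [← sub_div, div_div, div_le_div_iff₀ (by positivity) (by positivity)]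
    nlinarith
  · refine (min_le_right _ _).trans ?_
    have h' : (((b n).choose (k + 1) + (n + 1 - b n) * (b n).choose k : ℕ) : ℝ)
        + (((b n - k + (k + 1) - (n - q * (b n - k))).choose (k + 1) : ℕ) : ℝ)
      ≤ (q + 1) * bandwidth (graphG n (k + 1) (b n)) + 2 := by exact_mod_cast h
    rw [← add_div, ← sub_div, div_div, div_le_div_iff₀ (by positivity) (by positivity)]
    nlinarith

end Limits

/-! ### Comparison of the constants and conclusion -/

theorem c₁_pos {β : ℝ} (hβ : 0 < β) {k q : ℕ} (hk : 1 ≤ k) (hq : 1 ≤ q) : 0 < c₁ β k q := by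
  have hk' : (1 : ℝ) ≤ k := by exact_mod_cast hk
  have hq' : (1 : ℝ) ≤ q := by exact_mod_cast hq
  have h : ((k : ℝ) - 1) / q ≤ k - 1 := div_le_self (by linarith) hq'
  unfold c₁
  exact mul_pos (by positivity) (by linarith)

theorem upperCoeff_eq_c₁ {β r : ℝ} {k q : ℕ} (hk : 1 ≤ k) (hq : 2 ≤ q) (hr : 0 ≤ r)
    (hqr : 1 = q * β + r) (h : r ≤ ((q : ℝ) - 1) / ((q : ℝ) ^ 2 + q - 1)) :
    upperCoeff β r k q = c₁ β k q := by
  have hq' : (2 : ℝ) ≤ q := by exact_mod_cast hq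
  obtain ⟨k, rfl⟩ := Nat.exists_eq_add_of_le' hk
  rw [le_div_iff₀ (by nlinarith)] at h
  -- This is the condition on `r`, rewritten with `q β = 1 - r`; it selects the linear branch of the
  -- profile.
  have h1 : β ≤ q * (β - r) := by
    have h2 : q * β ≤ q * (q * (β - r)) := by
      nlinarith
    exact le_of_mul_le_mul_left h2 (by linarith)
  rw [upperCoeff, profile_of_ge (by nlinarith), profile_of_ge h1, c₁]
  simp only [Nat.add_sub_cancel]
  have hq0 : (q : ℝ) ≠ 0 := by positivity
  push_cast
  field_simp
  ring

theorem upperCoeff_eq_add {β r : ℝ} {k q : ℕ} (hk : 1 ≤ k) (hq : 2 ≤ q) (hr : 0 ≤ r)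
    (hqr : 1 = q * β + r) (h : ((q : ℝ) - 1) / ((q : ℝ) ^ 2 + q - 1) < r) :
    upperCoeff β r k q = c₂ β k q + c₃ β r k q := by
  have hq' : (2 : ℝ) ≤ q := by exact_mod_cast hq
  obtain ⟨k, rfl⟩ := Nat.exists_eq_add_of_le' hk
  rw [div_lt_iff₀ (by nlinarith)] at h
  have h1 : q * (β - r) ≤ β := by
    have h2 : q * (q * (β - r)) ≤ q * β := by
      nlinarith
    exact le_of_mul_le_mul_left h2 (by linarith)
  rw [upperCoeff, profile_of_ge (by nlinarith), profile_of_le h1, c₂, c₃, ← hqr]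
  simp only [Nat.add_sub_cancel]
  have hq0 : (q : ℝ) ≠ 0 := by positivity
  push_cast
  rw [mul_pow]
  field_simp
  ring

theorem asympLE_of_le_tendsto {f : ℕ → ℝ} {u : ℕ → ℝ} {C : ℝ} {k : ℕ} (hC : 0 < C)
    (hu : Tendsto u atTop (nhds C)) (h : ∀ᶠ n : ℕ in atTop, f n / (n : ℝ) ^ k ≤ u n) :
    AsympLE f fun n => C * (n : ℝ) ^ k := by
  intro ε hε
  filter_upwards [h, hu.eventually_lt_const (by nlinarith : C < (1 + ε) * C),
    eventually_gt_atTop 0] with n h1 h2 h3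
  have := h1.trans h2.le
  rw [div_le_iff₀ (by positivity)] at this
  linarith

theorem asympLE_of_tendsto_le {f : ℕ → ℝ} {l : ℕ → ℝ} {C : ℝ} {k : ℕ} (hC : 0 < C)
    (hl : Tendsto l atTop (nhds C)) (h : ∀ᶠ n : ℕ in atTop, l n ≤ f n / (n : ℝ) ^ k) :
    AsympLE (fun n => C * (n : ℝ) ^ k) f := by
  intro ε hε
  have hlt : C / (1 + ε) < C := div_lt_self hC (by linarith)
  filter_upwards [h, hl.eventually_const_lt hlt, eventually_gt_atTop 0] with n h1 h2 h3
  have := h2.le.trans h1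
  rw [le_div_iff₀ (by positivity), div_mul_eq_mul_div, div_le_iff₀ (by positivity)] at this
  linarith

theorem theorem2 (k : ℕ) (hk : 2 ≤ k) (β : ℝ) (hβ : 0 < β) (hβ' : β ≤ 1 / 2)
    (b : ℕ → ℕ) (hb : (fun n => (b n : ℝ)) ~[atTop] fun n : ℕ => β * (n : ℝ))
    (q : ℕ) (hq : 2 ≤ q) (r : ℝ) (hr : 0 ≤ r) (hrβ : r < β) (hqr : 1 = (q : ℝ) * β + r) :
    (r ≤ ((q : ℝ) - 1) / ((q : ℝ) ^ 2 + (q : ℝ) - 1) →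
      (fun n => (bandwidth (graphG n k (b n)) : ℝ)) ~[atTop]
        fun n : ℕ => c₁ β k q * (n : ℝ) ^ k) ∧
    (((q : ℝ) - 1) / ((q : ℝ) ^ 2 + (q : ℝ) - 1) < r →
      AsympLE
        (fun n => max (c₁ β k q) (c₂ β k q + 1 / (q : ℝ) ^ (k - 1) * c₃ β r k q) * (n : ℝ) ^ k)
        (fun n => (bandwidth (graphG n k (b n)) : ℝ)) ∧
      AsympLE
        (fun n => (bandwidth (graphG n k (b n)) : ℝ))
        (fun n => (c₂ β k q + c₃ β r k q) * (n : ℝ) ^ k)) := by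
  have hlim : Tendsto (fun n => (b n : ℝ) / n) atTop (nhds β) := by
    have h0 : ∀ᶠ n : ℕ in atTop, β * (n : ℝ) ≠ 0 := by
      filter_upwards [eventually_gt_atTop 0] with n hn
      positivity
    have := ((isEquivalent_iff_tendsto_one h0).1 hb).const_mul β
    rw [mul_one] at this
    refine this.congr fun n => ?_
    simp only [Pi.div_apply]
    field_simp
  have hk1 : 1 ≤ k := by omega
  have hq2 : (2 : ℝ) ≤ q := by exact_mod_cast hq
  have hc₁ : 0 < c₁ β k q := c₁_pos hβ hk1 (by omega)
  obtain ⟨u, hu, hBu⟩ := exists_upper_bound hk (by omega : 1 ≤ q) hr hrβ hqr hlim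
  obtain ⟨j, rfl⟩ := Nat.exists_eq_add_of_le' hk1
  obtain ⟨l, hl, hlB⟩ := exists_lower_bound (k := j) hq hr hrβ hqr hlim
  refine ⟨fun h => ?_, fun h => ?_⟩
  · rw [upperCoeff_eq_c₁ hk1 hq hr hqr h] at hu
    have hB := tendsto_of_tendsto_of_tendsto_of_le_of_le' hl hu hlB hBu
    have h0 : ∀ᶠ n : ℕ in atTop, c₁ β (j + 1) q * (n : ℝ) ^ (j + 1) ≠ 0 := by
      filter_upwards [eventually_gt_atTop 0] with n hn
      positivity
    refine (isEquivalent_iff_tendsto_one h0).2 ?_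
    have := hB.div_const (c₁ β (j + 1) q)
    rw [div_self hc₁.ne'] at this
    refine this.congr fun n => ?_
    rw [Pi.div_apply, div_div, mul_comm]
  · have hr0 : 0 < r := (div_pos (by linarith) (by nlinarith)).trans h
    rw [upperCoeff_eq_add hk1 hq hr hqr h] at hu
    obtain ⟨l', hl', hlB'⟩ := exists_lower_bound_of_pos (k := j) hq hr0 hrβ hqr hlim
    -- The inequality `c₁ ≤ c₂ + c₃`, needed for positivity of the upper constant, is read off from
    -- the two bounds on the same bandwidth.
    have hC := le_of_tendsto_of_tendsto hl hu (by
      filter_upwards [hlB, hBu] with n h1 h2 using h1.trans h2)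
    refine ⟨asympLE_of_tendsto_le (lt_max_of_lt_left hc₁) (hl.max hl') ?_,
      asympLE_of_le_tendsto (hc₁.trans_le hC) hu hBu⟩
    filter_upwards [hlB, hlB'] with n h1 h2 using max_le h1 h2
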